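/- **Conventions.** Fix $\nu\ge 1$. For $k,l\in\mathbb{R}^\nu$ write $k\le l$ if $k_i\le l_i$ for all $i$; for $k\in\mathbb{C}^\nu$ put $\Re(k)=(\Re(k_1),\dots,\Re(k_\nu))$ and $\bar k=(\bar k_1,\dots,\bar k_\nu)$. Sesquilinear forms are anti-linear in the first variable. **$C^*$-calculus.** A $C^*$-calculus with $\nu$ parameters is a family of complex vector spaces $(\mathcal{A}_k)_{k\in\mathbb{C}^\nu}$ with bilinear associative products $\mathcal{A}_k\times\mathcal{A}_l\to\mathcal{A}_{k+l}$, a unit $0\ne 1\in\mathcal{A}_0$, an anti-linear involution $a\mapsto a^*$, $\mathcal{A}_k\to\mathcal{A}_{\bar k}$, with $a^{**}=a$, $1^*=1$, $(ab)^*=b^*a^*$, and a $C^*$-semi-norm on $\mathcal{A}_0$ (a semi-norm with $\|ab\|\le\|a\|\|b\|$ and $\|a^*a\|=\|a\|^2$). Let $\overline{\mathcal{A}_0}$ be the $C^*$-algebra obtained as Hausdorff completion of $\mathcal{A}_0$; an element $a\in\mathcal A_0$ is called (left-)invertible in $\overline{\mathcal{A}_0}$ if its image there is. **Representations.** A representation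 $\pi$ of $(\mathcal{A}_k)$ is a non-zero complex vector space $C^\infty(\pi)$ with a positive definite sesquilinear form $\langle\cdot,\cdot\rangle$, whose Hilbert space completion is denoted $L^2(\pi)$, and linear maps $\pi_k:\mathcal{A}_k\to\mathrm{End}(C^\infty(\pi))$, such that 1. $\pi_0(1)=\mathrm{Id}$, $\pi_k(a)\pi_l(b)=\pi_{k+l}(ab)$, $\langle\pi_k(a)\xi,\eta\rangle=\langle\xi,\pi_{\bar k}(a^*)\eta\rangle$; 2. if $\Re(k)\le 0$ and $a\in\mathcal{A}_k$, then $\pi_k(a)$ extends to a bounded operator on $L^2(\pi)$, and $\|\pi_0(a)\|_{\mathcal L(L^2(\pi))}\le\|a\|$ for $a\in\mathcal{A}_0$ (so $\pi_0$ extends to a representation of $\overline{\mathcal{A}_0}$ on $L^2(\pi)$); 3. $C^\infty(\pi)$ is complete for the topology generated by the semi-norms $\xi\mapsto\|\pi_k(a)\xi\|_{L^2(\pi)}$, $k\in\mathbb{C}^\nu$, $a\in\mathcal{A}_k$. This is the topology used on $C^\infty(\pi)$. Let $C^{-\infty}(\pi)$ be the space of continuous anti-linear functionals on $C^\infty(\pi)$,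 $\eta\mapsto\langle\eta,\xi\rangle$, with the topology of pointwise convergence, so that $C^\infty(\pi)\subseteq L^2(\pi)\subseteq C^{-\infty}(\pi)$. Each $\pi_k(a)$ extends to $C^{-\infty}(\pi)$ by $\langle\eta,\pi_k(a)\xi\rangle=\langle\pi_{\bar k}(a^*)\eta,\xi\rangle$. For $k\in\mathbb{R}^\nu$ let $H^k(\pi)$ be the set of $\xi\in C^{-\infty}(\pi)$ for which there is a sequence $(\xi_n)$ in $C^\infty(\pi)$ with $\xi_n\to\xi$ in $C^{-\infty}(\pi)$ such that for all $l\in\mathbb{C}^\nu$ with $\Re(l)\le k$ and all $a\in\mathcal{A}_l$ one has $\pi_l(a)\xi\in L^2(\pi)$ and $\pi_l(a)\xi_n\to\pi_l(a)\xi$ in $L^2(\pi)$. Give $H^k(\pi)$ the topology generated by the semi-norms $\xi\mapsto\|\pi_l(a)\xi\|_{L^2(\pi)}$ for such $l$ and $a$. If $a\in\mathcal A_k$, then $\pi_k(a)$ maps $H^l(\pi)$ into $H^{l-\Re(k)}(\pi)$ for every $l\in\mathbb R^\nu$. A unital $C^*$-algebra $B$ is of Type I if $\mathcal{K}(L^2(\rho))\subseteq\rho(B)$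 for every irreducible representation $\rho$ of $B$, where $\mathcal K$ denotes the compact operators. Let $K$ be the set of $k\in\mathbb{C}^\nu$ with $k_i\ne0$ for at most one $i$ and $\Re(k_i),\Im(k_i)\in[-1,1]$ for all $i$. **Theorem.** Let $(\mathcal{A}_k)_{k\in\mathbb{C}^\nu}$ be a $C^*$-calculus and $\Sigma$ a set of representations of it such that: 1. the $C^*$-algebra $\overline{\mathcal{A}_0}$ is of Type I; 2. every irreducible representation of $\overline{\mathcal{A}_0}$ is unitarily equivalent to (the extension to $\overline{\mathcal{A}_0}$ of) $\pi_0$ for some $\pi\in\Sigma$; 3. there are elements $v_k\in\mathcal{A}_k$, $k\in K$, such that $v_0$ is invertible in $\overline{\mathcal{A}_0}$ and, for every $a\in\mathcal{A}_0$, the map $K\to\overline{\mathcal{A}_0}$, $k\mapsto v_k\,a\,v_{-k}$, is norm continuous. Then the following hold. (i) Let $k\in\mathbb{C}^\nu$ and $a\in\mathcal{A}_k$ be such that for every $\pi\in\Sigma$ the maps $\pi_k(a)$ and $\pi_{\bar k}(a^*)$ are injective on $C^\infty(\pi)$. Then for every representation $\pi$ of the calculus (not necessarily irreducible, not necessarily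 in $\Sigma$) the maps $$\pi_k(a):C^{-\infty}(\pi)\to C^{-\infty}(\pi),\qquad \pi_k(a):H^l(\pi)\to H^{l-\Re(k)}(\pi)\ \ (l\in\mathbb{R}^\nu),\qquad \pi_k(a):C^\infty(\pi)\to C^\infty(\pi)$$ are topological isomorphisms. Furthermore, for every $k\in\mathbb{C}^\nu$ there is an $a\in\mathcal{A}_k$ that satisfies this injectivity hypothesis, and hence the conclusion. (ii) For every representation $\pi$ of the calculus and every $k\in\mathbb{R}^\nu$, the space $H^k(\pi)$ is Hilbertian (its topology is that of a Hilbert space), and $$H^k(\pi)=\{\xi\in C^{-\infty}(\pi):\ \pi_k(a)\xi\in L^2(\pi)\ \text{ for all } a\in\mathcal{A}_k\};$$ moreover $C^{-\infty}(\pi)=\bigcup_{k\in\mathbb{R}^\nu}H^k(\pi)$. (iii) An element $a\in\mathcal{A}_0$ is left-invertible in $\overline{\mathcal{A}_0}$ if and only if $\pi_0(a):C^\infty(\pi)\to C^\infty(\pi)$ is injective for all $\pi\in\Sigma$. -/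

import Mathlib

open Filter Topology UniformSpace

universe u v w

noncomputable section

/-! ### Seminorm topologies and Hilbertian spaces -/

/-- The uniform structure generated by a family of seminorms. -/
abbrev uniformSpaceOfSeminorms {E ι : Type*} [AddCommGroup E] [Module ℂ E]
    (p : ι → Seminorm ℂ E) : UniformSpace E :=
  ⨅ i, (p i).toSeminormedAddCommGroup.toUniformSpace

/-- A topological vector space is Hilbertian if it is isomorphic, as a topological vector space,
to a Hilbert space. -/
def IsHilbertian (E : Type w) [AddCommGroup E] [Module ℂ E] [TopologicalSpace E] : Prop :=
  ∃ (H : Type w) (_ : NormedAddCommGroup H) (_ : InnerProductSpace ℂ H) (_ : CompleteSpace H),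
    Nonempty (E ≃L[ℂ] H)

/-! ### Representations of C⋆-algebras -/

section CStarRepresentations

variable {B : Type u} [CStarAlgebra B]
  {H : Type v} [NormedAddCommGroup H] [InnerProductSpace ℂ H] [CompleteSpace H]
  {K : Type w} [NormedAddCommGroup K] [InnerProductSpace ℂ K] [CompleteSpace K]

/-- (Topological) irreducibility of a unital representation of a C⋆-algebra on a Hilbert space:
the space is non-zero and has no closed invariant subspace except `0` and the whole space. -/
def IsIrreducibleRep (ρ : B →⋆ₐ[ℂ] (H →L[ℂ] H)) : Prop :=
  Nontrivial H ∧ ∀ L : Submodule ℂ H, IsClosed (L : Set H) →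
    (∀ b : B, ∀ ξ ∈ L, ρ b ξ ∈ L) → L = ⊥ ∨ L = ⊤

/-- Unitary equivalence of representations. -/
def UnitarilyEquivalent (ρ : B →⋆ₐ[ℂ] (H →L[ℂ] H)) (σ : B →⋆ₐ[ℂ] (K →L[ℂ] K)) : Prop :=
  ∃ U : H ≃ₗᵢ[ℂ] K, ∀ (b : B) (ξ : H), U (ρ b ξ) = σ b (U ξ)

end CStarRepresentations

/-- A unital C⋆-algebra `B` is of Type I if for every irreducible representation `ρ` of `B` all
compact operators lie in `ρ(B)`. Irreducible representations are cyclic, so, up to unitary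
equivalence, all of them live on Hilbert spaces in the universe of `B`. -/
def IsTypeI (B : Type u) [CStarAlgebra B] : Prop :=
  ∀ (H : Type u) [NormedAddCommGroup H] [InnerProductSpace ℂ H] [CompleteSpace H]
    (ρ : B →⋆ₐ[ℂ] (H →L[ℂ] H)), IsIrreducibleRep ρ →
      ∀ T : H →L[ℂ] H, IsCompactOperator T → ∃ b : B, ρ b = T

/-! ### C⋆-calculi -/

/-- A C⋆-calculus with `ν` parameters. The product `A_k × A_l → A_{k+l}` is given as a map with
values in `A_m` for the index `m` equal to `k + l`, and the involution `A_k → A_{k̄}` as a map with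
values in `A_m` for the index `m` equal to `k̄`; this only avoids transports along equalities of
indices. `star k` is the componentwise complex conjugate of `k`. -/
structure CStarCalculus (ν : ℕ) where
  /-- the space of elements of order `k` -/
  obj : (Fin ν → ℂ) → Type u
  [addCommGroup : ∀ k, AddCommGroup (obj k)]
  [module : ∀ k, Module ℂ (obj k)]
  /-- the product -/
  mul : ∀ {k l m : Fin ν → ℂ}, k + l = m → obj k →ₗ[ℂ] obj l →ₗ[ℂ] obj m
  mul_assoc : ∀ {k₁ k₂ k₃ k₁₂ k₂₃ m : Fin ν → ℂ} (h₁₂ : k₁ + k₂ = k₁₂) (h : k₁₂ + k₃ = m)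
    (h₂₃ : k₂ + k₃ = k₂₃) (h' : k₁ + k₂₃ = m) (a : obj k₁) (b : obj k₂) (c : obj k₃),
    mul h (mul h₁₂ a b) c = mul h' a (mul h₂₃ b c)
  /-- the unit -/
  one : obj 0
  one_ne_zero : one ≠ 0
  one_mul : ∀ {k : Fin ν → ℂ} (a : obj k), mul (zero_add k) one a = a
  mul_one : ∀ {k : Fin ν → ℂ} (a : obj k), mul (add_zero k) a one = a
  /-- the involution -/
  adj : ∀ {k m : Fin ν → ℂ}, star k = m → obj k →ₗ⋆[ℂ] obj m
  adj_adj : ∀ {k m : Fin ν → ℂ} (h : star k = m) (h' : star m = k) (a : obj k),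
    adj h' (adj h a) = a
  adj_one : adj (star_zero _) one = one
  adj_mul : ∀ {k l m k' l' m' : Fin ν → ℂ} (h : k + l = m) (hk : star k = k') (hl : star l = l')
    (hm : star m = m') (h' : l' + k' = m') (a : obj k) (b : obj l),
    adj hm (mul h a b) = mul h' (adj hl b) (adj hk a)
  /-- the C⋆-seminorm on the elements of order `0` -/
  seminorm : Seminorm ℂ (obj 0)
  seminorm_mul_le : ∀ a b : obj 0, seminorm (mul (zero_add 0) a b) ≤ seminorm a * seminorm b
  seminorm_adj_mul_self : ∀ a : obj 0,
    seminorm (mul (zero_add 0) (adj (star_zero _) a) a) = seminorm a ^ 2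

namespace CStarCalculus

variable {ν : ℕ}

instance (𝒜 : CStarCalculus.{u} ν) (k : Fin ν → ℂ) : AddCommGroup (𝒜.obj k) := 𝒜.addCommGroup k

instance (𝒜 : CStarCalculus.{u} ν) (k : Fin ν → ℂ) : Module ℂ (𝒜.obj k) := 𝒜.module k

/-- The ⋆-algebra of elements of order `0`, with the C⋆-seminorm of the calculus. -/
def Alg₀ (𝒜 : CStarCalculus.{u} ν) : Type u := 𝒜.obj 0

section Alg₀

variable (𝒜 : CStarCalculus.{u} ν)

instance : AddCommGroup 𝒜.Alg₀ := inferInstanceAs (AddCommGroup (𝒜.obj 0))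

instance : Module ℂ 𝒜.Alg₀ := inferInstanceAs (Module ℂ (𝒜.obj 0))

instance : Ring 𝒜.Alg₀ where
  __ := (inferInstance : AddCommGroup 𝒜.Alg₀)
  mul a b := 𝒜.mul (zero_add 0) a b
  one := 𝒜.one
  mul_assoc a b c := 𝒜.mul_assoc _ _ _ _ a b c
  one_mul a := 𝒜.one_mul a
  mul_one a := 𝒜.mul_one a
  left_distrib a b c := map_add (𝒜.mul (zero_add 0) a) b c
  right_distrib a b c := LinearMap.map_add₂ (𝒜.mul (zero_add 0)) a b c
  zero_mul a := LinearMap.map_zero₂ (𝒜.mul (zero_add 0)) a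
  mul_zero a := map_zero (𝒜.mul (zero_add 0) a)

theorem Alg₀.mul_def (a b : 𝒜.Alg₀) : a * b = 𝒜.mul (zero_add 0) a b := rfl

theorem Alg₀.one_def : (1 : 𝒜.Alg₀) = 𝒜.one := rfl

instance : Algebra ℂ 𝒜.Alg₀ :=
  Algebra.ofModule (fun r a b => LinearMap.map_smul₂ (𝒜.mul (zero_add 0)) r a b)
    (fun r a b => map_smul (𝒜.mul (zero_add 0) a) r b)

instance : StarRing 𝒜.Alg₀ where
  star a := 𝒜.adj (star_zero _) a
  star_involutive a := 𝒜.adj_adj _ _ a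
  star_mul a b := 𝒜.adj_mul _ _ _ _ _ a b
  star_add a b := map_add (𝒜.adj (star_zero _)) a b

theorem Alg₀.star_def (a : 𝒜.Alg₀) : star a = 𝒜.adj (star_zero _) a := rfl

instance : StarModule ℂ 𝒜.Alg₀ where
  star_smul r a := map_smulₛₗ (𝒜.adj (star_zero _)) r a

instance : SeminormedRing 𝒜.Alg₀ where
  toRing := inferInstance
  toNorm := 𝒜.seminorm.toSeminormedAddCommGroup.toNorm
  toPseudoMetricSpace := 𝒜.seminorm.toSeminormedAddCommGroup.toPseudoMetricSpace
  dist_eq := 𝒜.seminorm.toSeminormedAddCommGroup.dist_eq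
  norm_mul_le a b := 𝒜.seminorm_mul_le a b

theorem Alg₀.norm_def (a : 𝒜.Alg₀) : ‖a‖ = 𝒜.seminorm a := rfl

instance : NormedAlgebra ℂ 𝒜.Alg₀ where
  toAlgebra := inferInstance
  norm_smul_le r a := (map_smul_eq_mul 𝒜.seminorm r a).le

theorem Alg₀.norm_star_mul_self (a : 𝒜.Alg₀) : ‖star a * a‖ = ‖a‖ ^ 2 :=
  𝒜.seminorm_adj_mul_self a

theorem Alg₀.norm_star (a : 𝒜.Alg₀) : ‖star a‖ = ‖a‖ := by
  have key : ∀ b : 𝒜.Alg₀, ‖b‖ ≤ ‖star b‖ := fun b => by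
    have h := norm_mul_le (star b) b
    rw [Alg₀.norm_star_mul_self] at h
    nlinarith [norm_nonneg b, norm_nonneg (star b)]
  exact le_antisymm (by simpa using key (star a)) (key a)

instance : NormedStarGroup 𝒜.Alg₀ where
  norm_star_le a := (Alg₀.norm_star 𝒜 a).le

/-- The Hausdorff completion of the algebra of elements of order `0`. -/
abbrev Completed₀ : Type u := Completion 𝒜.Alg₀

theorem Alg₀.uniformContinuous_star : UniformContinuous (star : 𝒜.Alg₀ → 𝒜.Alg₀) :=
  (AddMonoidHomClass.isometry_of_norm (starAddEquiv : 𝒜.Alg₀ ≃+ 𝒜.Alg₀)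
    (Alg₀.norm_star 𝒜)).uniformContinuous

instance : Star 𝒜.Completed₀ where
  star := Completion.map star

theorem Completed₀.coe_star (a : 𝒜.Alg₀) : ((star a : 𝒜.Alg₀) : 𝒜.Completed₀) = star ↑a :=
  (Completion.map_coe (Alg₀.uniformContinuous_star 𝒜) a).symm

theorem Completed₀.continuous_star : Continuous (star : 𝒜.Completed₀ → 𝒜.Completed₀) :=
  Completion.continuous_map

instance : ContinuousStar 𝒜.Completed₀ := ⟨Completed₀.continuous_star 𝒜⟩

instance : StarRing 𝒜.Completed₀ where
  star_involutive x := by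
    induction x using Completion.induction_on with
    | hp => exact isClosed_eq (by fun_prop) (by fun_prop)
    | ih a => rw [← Completed₀.coe_star, ← Completed₀.coe_star, star_star]
  star_mul x y := by
    induction x, y using Completion.induction_on₂ with
    | hp => exact isClosed_eq (by fun_prop) (by fun_prop)
    | ih a b =>
      rw [← Completion.coe_mul, ← Completed₀.coe_star, ← Completed₀.coe_star,
        ← Completed₀.coe_star, ← Completion.coe_mul, star_mul]
  star_add x y := by
    induction x, y using Completion.induction_on₂ with
    | hp => exact isClosed_eq (by fun_prop) (by fun_prop)
    | ih a b =>
      rw [← Completion.coe_add, ← Completed₀.coe_star, ← Completed₀.coe_star,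
        ← Completed₀.coe_star, ← Completion.coe_add, star_add]

instance : CStarAlgebra 𝒜.Completed₀ where
  toAlgebra := inferInstance
  norm_mul_self_le x := by
    induction x using Completion.induction_on with
    | hp => exact isClosed_le (by fun_prop) (by fun_prop)
    | ih a =>
      rw [← Completed₀.coe_star, ← Completion.coe_mul, Completion.norm_coe, Completion.norm_coe,
        Alg₀.norm_star_mul_self, sq]
  norm_smul_le r x := norm_smul_le r x
  star_smul r x := by
    induction x using Completion.induction_on with
    | hp =>
      exact isClosed_eq ((Completed₀.continuous_star 𝒜).comp (continuous_const_smul r))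
        ((continuous_const_smul (star r)).comp (Completed₀.continuous_star 𝒜))
    | ih a =>
      rw [← Completion.coe_smul, ← Completed₀.coe_star, ← Completed₀.coe_star,
        ← Completion.coe_smul, star_smul]

/-- The image in the completed algebra of an element of order `0`. -/
def toCompleted₀ (a : 𝒜.obj 0) : 𝒜.Completed₀ := ((show 𝒜.Alg₀ from a : 𝒜.Alg₀) : 𝒜.Completed₀)

end Alg₀

/-! ### Representations of a C⋆-calculus -/

/-- A representation of a C⋆-calculus. `V` is the space `C^∞(π)` of smooth vectors. Its norm is
the one of its inner product (linear in the second variable); its topology as the space of smooth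
vectors is the one generated by the seminorms `ξ ↦ ‖π_k(a) ξ‖`, for all `k` and all `a` of order
`k`, see `Smooth`. -/
structure Rep (𝒜 : CStarCalculus.{u} ν) where
  /-- the smooth vectors -/
  V : Type w
  [normedAddCommGroup : NormedAddCommGroup V]
  [innerProductSpace : InnerProductSpace ℂ V]
  [nontrivial : Nontrivial V]
  /-- the maps `π_k` -/
  act : ∀ k : Fin ν → ℂ, 𝒜.obj k →ₗ[ℂ] V →ₗ[ℂ] V
  act_one : act 0 𝒜.one = LinearMap.id
  act_mul : ∀ {k l m : Fin ν → ℂ} (h : k + l = m) (a : 𝒜.obj k) (b : 𝒜.obj l),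
    act m (𝒜.mul h a b) = act k a ∘ₗ act l b
  inner_act : ∀ {k m : Fin ν → ℂ} (h : star k = m) (a : 𝒜.obj k) (ξ η : V),
    inner ℂ (act k a ξ) η = inner ℂ ξ (act m (𝒜.adj h a) η)
  bounded : ∀ k : Fin ν → ℂ, (∀ i, (k i).re ≤ 0) → ∀ a : 𝒜.obj k,
    ∃ C : ℝ, ∀ ξ : V, ‖act k a ξ‖ ≤ C * ‖ξ‖
  norm_act_le : ∀ (a : 𝒜.obj 0) (ξ : V), ‖act 0 a ξ‖ ≤ 𝒜.seminorm a * ‖ξ‖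
  complete : @CompleteSpace V (uniformSpaceOfSeminorms
    fun a : (k : Fin ν → ℂ) × 𝒜.obj k => (normSeminorm ℂ V).comp (act a.1 a.2))

namespace Rep

variable {𝒜 : CStarCalculus.{u} ν}

instance (π : 𝒜.Rep) : NormedAddCommGroup π.V := π.normedAddCommGroup

instance (π : 𝒜.Rep) : InnerProductSpace ℂ π.V := π.innerProductSpace

instance (π : 𝒜.Rep) : Nontrivial π.V := π.nontrivial

variable (π : Rep.{u, w} 𝒜)

/-- The Hilbert space `L²(π)`. -/
abbrev L2 : Type w := Completion π.V

/-- The bounded operator on `C^∞(π)`, with the Hilbert norm, given by an element of order `0`. -/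
def act₀ (a : 𝒜.Alg₀) : π.V →L[ℂ] π.V :=
  (π.act 0 a).mkContinuous ‖a‖ (π.norm_act_le a)

theorem act₀_apply (a : 𝒜.Alg₀) (ξ : π.V) : π.act₀ a ξ = π.act 0 a ξ := rfl

/-- The extension of `π_0` to bounded operators on `L²(π)`. -/
def l2Act₀ : 𝒜.Alg₀ →ₐ[ℂ] (π.L2 →L[ℂ] π.L2) :=
  AlgHom.ofLinearMap
    { toFun := fun a => (π.act₀ a).completion
      map_add' := fun a b => by
        ext x
        induction x using Completion.induction_on with
        | hp => exact isClosed_eq (map_continuous _) (map_continuous _)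
        | ih x =>
          have h : π.act 0 (a + b : 𝒜.Alg₀) x = π.act 0 a x + π.act 0 b x :=
            LinearMap.map_add₂ (π.act 0) a b x
          simp [act₀_apply, h, Completion.coe_add]
      map_smul' := fun r a => by
        ext x
        induction x using Completion.induction_on with
        | hp => exact isClosed_eq (map_continuous _) (map_continuous _)
        | ih x =>
          have h : π.act 0 (r • a : 𝒜.Alg₀) x = r • π.act 0 a x :=
            LinearMap.map_smul₂ (π.act 0) r a x
          simp [act₀_apply, h, Completion.coe_smul] }
    (by
      ext x
      induction x using Completion.induction_on with
      | hp => exact isClosed_eq (map_continuous _) (map_continuous _)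
      | ih x =>
        have h : π.act 0 (1 : 𝒜.Alg₀) x = x := LinearMap.congr_fun π.act_one x
        simp [act₀_apply, h])
    (fun a b => by
      ext x
      induction x using Completion.induction_on with
      | hp => exact isClosed_eq (map_continuous _) (map_continuous _)
      | ih x =>
        have h : π.act 0 (a * b : 𝒜.Alg₀) x = π.act 0 a (π.act 0 b x) :=
          LinearMap.congr_fun (π.act_mul (zero_add 0) a b) x
        simp [act₀_apply, h])

theorem l2Act₀_coe (a : 𝒜.Alg₀) (ξ : π.V) : π.l2Act₀ a (ξ : π.L2) = (π.act 0 a ξ : π.V) := by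
  simp [l2Act₀, act₀_apply]

theorem norm_l2Act₀_le (a : 𝒜.Alg₀) : ‖π.l2Act₀ a‖ ≤ ‖a‖ := by
  refine ContinuousLinearMap.opNorm_le_bound _ (norm_nonneg _) fun x => ?_
  induction x using Completion.induction_on with
  | hp => exact isClosed_le (by fun_prop) (by fun_prop)
  | ih x =>
    rw [l2Act₀_coe, Completion.norm_coe, Completion.norm_coe]
    exact π.norm_act_le a x

theorem continuous_l2Act₀ : Continuous π.l2Act₀ :=
  AddMonoidHomClass.continuous_of_bound π.l2Act₀ 1
    fun a => by simpa using π.norm_l2Act₀_le a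

theorem l2Act₀_star (a : 𝒜.Alg₀) : π.l2Act₀ (star a) = star (π.l2Act₀ a) := by
  rw [ContinuousLinearMap.star_eq_adjoint, ContinuousLinearMap.eq_adjoint_iff]
  intro x y
  induction x, y using Completion.induction_on₂ with
  | hp => exact isClosed_eq (by fun_prop) (by fun_prop)
  | ih x y =>
    rw [l2Act₀_coe, l2Act₀_coe, Completion.inner_coe, Completion.inner_coe]
    have h := π.inner_act (star_zero _) (𝒜.adj (star_zero _) (show 𝒜.obj 0 from a)) x y
    rw [𝒜.adj_adj (star_zero _) (star_zero _)] at h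
    exact h

/-- The extension of `π_0` to the completed algebra of order `0`, as a ring homomorphism. -/
def l2RingHom : 𝒜.Completed₀ →+* (π.L2 →L[ℂ] π.L2) :=
  Completion.extensionHom (π.l2Act₀ : 𝒜.Alg₀ →+* (π.L2 →L[ℂ] π.L2)) π.continuous_l2Act₀

theorem l2RingHom_coe (a : 𝒜.Alg₀) : π.l2RingHom (a : 𝒜.Completed₀) = π.l2Act₀ a :=
  Completion.extensionHom_coe (π.l2Act₀ : 𝒜.Alg₀ →+* (π.L2 →L[ℂ] π.L2)) π.continuous_l2Act₀ a

theorem continuous_l2RingHom : Continuous π.l2RingHom := Completion.continuous_extension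

/-- The representation of the completed algebra of order `0` on `L²(π)` that extends `π_0`. -/
def l2Rep : 𝒜.Completed₀ →⋆ₐ[ℂ] (π.L2 →L[ℂ] π.L2) where
  __ := π.l2RingHom
  commutes' r := (π.l2RingHom_coe _).trans (π.l2Act₀.commutes r)
  map_star' x := by
    change π.l2RingHom (star x) = star (π.l2RingHom x)
    induction x using Completion.induction_on with
    | hp =>
      exact isClosed_eq (π.continuous_l2RingHom.comp (Completed₀.continuous_star 𝒜))
        (continuous_star.comp π.continuous_l2RingHom)
    | ih a => rw [← Completed₀.coe_star, l2RingHom_coe, l2RingHom_coe, l2Act₀_star]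

theorem l2Rep_coe (a : 𝒜.Alg₀) (ξ : π.V) :
    π.l2Rep (a : 𝒜.Completed₀) (ξ : π.L2) = (π.act 0 a ξ : π.V) := by
  rw [← l2Act₀_coe, ← l2RingHom_coe]
  rfl

/-! ### Smooth vectors -/

/-- The space `C^∞(π)` of smooth vectors, with the topology generated by the seminorms
`ξ ↦ ‖π_k(a) ξ‖`. -/
def Smooth : Type w := π.V

instance : AddCommGroup π.Smooth := inferInstanceAs (AddCommGroup π.V)

instance : Module ℂ π.Smooth := inferInstanceAs (Module ℂ π.V)

/-- The seminorm `ξ ↦ ‖π_k(a) ξ‖` on smooth vectors. -/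
def smoothSeminorm (a : (k : Fin ν → ℂ) × 𝒜.obj k) : Seminorm ℂ π.Smooth :=
  (normSeminorm ℂ π.V).comp (π.act a.1 a.2)

instance : UniformSpace π.Smooth := uniformSpaceOfSeminorms π.smoothSeminorm

instance : CompleteSpace π.Smooth := π.complete

instance : IsUniformAddGroup π.Smooth :=
  isUniformAddGroup_iInf fun a =>
    (π.smoothSeminorm a).toSeminormedAddCommGroup.to_isUniformAddGroup

theorem withSeminorms_smooth : WithSeminorms π.smoothSeminorm :=
  (SeminormFamily.withSeminorms_iff_uniformSpace_eq_iInf _).2 rfl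

/-- The operator `π_k(a) : C^∞(π) → C^∞(π)`, which is continuous. -/
def smoothAct {k : Fin ν → ℂ} (a : 𝒜.obj k) : π.Smooth →L[ℂ] π.Smooth where
  toLinearMap := (show π.Smooth →ₗ[ℂ] π.Smooth from π.act k a)
  cont := by
    refine π.withSeminorms_smooth.continuous_of_continuous_comp
      (show π.Smooth →ₗ[ℂ] π.Smooth from π.act k a) fun b => ?_
    have h : ⇑((π.smoothSeminorm b).comp (show π.Smooth →ₗ[ℂ] π.Smooth from π.act k a)) =
        π.smoothSeminorm ⟨b.1 + k, 𝒜.mul rfl b.2 a⟩ := by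
      funext ξ
      exact congrArg norm (LinearMap.congr_fun (π.act_mul rfl b.2 a) ξ).symm
    rw [h]
    exact π.withSeminorms_smooth.continuous_seminorm _

/-! ### Distribution vectors -/

/-- The space `C^{-∞}(π)` of continuous anti-linear functionals on `C^∞(π)`, with the topology of
pointwise convergence. The pairing `⟨η, ξ⟩` of a smooth vector `η` with `ξ` is `ξ η`. -/
abbrev Distr : Type w := π.Smooth →SLₚₜ[starRingEnd ℂ] ℂ

/-- The operator `π_k(a) : C^{-∞}(π) → C^{-∞}(π)`, given by `⟨η, π_k(a) ξ⟩ = ⟨π_{k̄}(a*) η, ξ⟩`. -/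
def distrAct {k : Fin ν → ℂ} (a : 𝒜.obj k) : π.Distr →L[ℂ] π.Distr :=
  PointwiseConvergenceCLM.precomp ℂ (π.smoothAct (𝒜.adj rfl a))

theorem distrAct_apply {k : Fin ν → ℂ} (a : 𝒜.obj k) (ξ : π.Distr) (η : π.Smooth) :
    π.distrAct a ξ η = ξ (π.smoothAct (𝒜.adj rfl a) η) := rfl

/-- The inclusion `C^∞(π) ⊆ L²(π)`. -/
def smoothToL2 : π.Smooth →ₗ[ℂ] π.L2 := (Completion.toComplₗᵢ (𝕜 := ℂ) (E := π.V)).toLinearMap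

theorem norm_smoothToL2 (η : π.Smooth) : ‖π.smoothToL2 η‖ = π.smoothSeminorm ⟨0, 𝒜.one⟩ η := by
  have h : π.smoothSeminorm ⟨0, 𝒜.one⟩ η = ‖(π.act 0 𝒜.one : π.V →ₗ[ℂ] π.V) η‖ := rfl
  rw [h, π.act_one]
  exact Completion.norm_coe (E := π.V) η

theorem continuous_smoothToL2 : Continuous π.smoothToL2 := by
  refine continuous_of_continuousAt_zero π.smoothToL2 ?_
  rw [ContinuousAt, map_zero, tendsto_zero_iff_norm_tendsto_zero]
  simp_rw [norm_smoothToL2]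
  have h := (π.withSeminorms_smooth.continuous_seminorm ⟨0, 𝒜.one⟩).tendsto 0
  rwa [map_zero] at h

/-- The inclusion `L²(π) ⊆ C^{-∞}(π)`, under which `⟨η, ξ⟩` is the inner product. -/
def l2ToDistr : π.L2 →ₗ[ℂ] π.Distr where
  toFun ξ :=
    { toFun := fun η => inner ℂ (π.smoothToL2 η) ξ
      map_add' := fun η₁ η₂ => by rw [map_add, inner_add_left]
      map_smul' := fun r η => by rw [map_smul, inner_smul_left, smul_eq_mul]
      cont := π.continuous_smoothToL2.inner continuous_const }
  map_add' ξ₁ ξ₂ := by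
    ext η
    exact inner_add_right (𝕜 := ℂ) (π.smoothToL2 η) ξ₁ ξ₂
  map_smul' r ξ := by
    ext η
    exact inner_smul_right (π.smoothToL2 η) ξ r

theorem l2ToDistr_apply (ξ : π.L2) (η : π.Smooth) :
    π.l2ToDistr ξ η = inner ℂ (π.smoothToL2 η) ξ := rfl

theorem l2ToDistr_injective : Function.Injective π.l2ToDistr := by
  rw [injective_iff_map_eq_zero]
  intro ξ hξ
  have h : ∀ η : π.L2, inner ℂ η ξ = 0 := fun η => by
    induction η using Completion.induction_on with
    | hp => exact isClosed_eq (by fun_prop) (by fun_prop)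
    | ih η => exact DFunLike.congr_fun hξ (show π.Smooth from η)
  exact inner_self_eq_zero.1 (h ξ)

theorem distrAct_l2ToDistr_smooth {k : Fin ν → ℂ} (a : 𝒜.obj k) (ξ : π.Smooth) :
    π.distrAct a (π.l2ToDistr (π.smoothToL2 ξ)) =
      π.l2ToDistr (π.smoothToL2 (π.smoothAct a ξ)) := by
  ext η
  let ξ' : π.V := ξ
  let η' : π.V := η
  change inner ℂ ((π.act _ (𝒜.adj rfl a) η' : π.V) : π.L2) (ξ' : π.L2) =
    inner ℂ (η' : π.L2) ((π.act k a ξ' : π.V) : π.L2)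
  rw [Completion.inner_coe, Completion.inner_coe, π.inner_act (star_star k), 𝒜.adj_adj]

theorem distrAct_distrAct {k l m : Fin ν → ℂ} (h : k + l = m) (a : 𝒜.obj k) (b : 𝒜.obj l)
    (ξ : π.Distr) : π.distrAct a (π.distrAct b ξ) = π.distrAct (𝒜.mul h a b) ξ := by
  ext η
  have h' : star l + star k = star m := by rw [← h, star_add, add_comm]
  have e := LinearMap.congr_fun (π.act_mul h' (𝒜.adj rfl b) (𝒜.adj rfl a)) η
  rw [← 𝒜.adj_mul h rfl rfl rfl h' a b] at e
  exact congrArg ξ e.symm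

/-! ### Sobolev spaces -/

/-- The vectors of the Sobolev space `H^k(π)`: the `ξ ∈ C^{-∞}(π)` for which there is a sequence
`ξ_n ∈ C^∞(π)` with `ξ_n → ξ` in `C^{-∞}(π)` such that, for all `a` of order `l` with `Re l ≤ k`,
`π_l(a) ξ ∈ L²(π)` and `π_l(a) ξ_n → π_l(a) ξ` in `L²(π)`. -/
def sobolevSubmodule (k : Fin ν → ℝ) : Submodule ℂ π.Distr where
  carrier := {ξ | ∃ x : ℕ → π.Smooth,
    Tendsto (fun n => π.l2ToDistr (π.smoothToL2 (x n))) atTop (𝓝 ξ) ∧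
    ∀ (l : Fin ν → ℂ) (a : 𝒜.obj l), (∀ i, (l i).re ≤ k i) →
      ∃ ζ : π.L2, π.distrAct a ξ = π.l2ToDistr ζ ∧
        Tendsto (fun n => π.smoothToL2 (π.smoothAct a (x n))) atTop (𝓝 ζ)}
  add_mem' := by
    rintro ξ ξ' ⟨x, hx, h⟩ ⟨x', hx', h'⟩
    refine ⟨fun n => x n + x' n, by simpa using hx.add hx', fun l a hl => ?_⟩
    obtain ⟨ζ, e, t⟩ := h l a hl
    obtain ⟨ζ', e', t'⟩ := h' l a hl
    exact ⟨ζ + ζ', by rw [map_add, map_add, e, e'], by simpa using t.add t'⟩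
  zero_mem' :=
    ⟨fun _ => 0, by simp, fun l a _ => ⟨0, by simp, by simp⟩⟩
  smul_mem' := by
    rintro r ξ ⟨x, hx, h⟩
    refine ⟨fun n => r • x n, by simpa using hx.const_smul r, fun l a hl => ?_⟩
    obtain ⟨ζ, e, t⟩ := h l a hl
    exact ⟨r • ζ, by rw [map_smul, map_smul, e], by simpa using t.const_smul r⟩

/-- The Sobolev space `H^k(π)` as a topological vector space, see `sobolevSeminorm`. -/
def Sobolev (k : Fin ν → ℝ) : Type w := π.sobolevSubmodule k

instance (k : Fin ν → ℝ) : AddCommGroup (π.Sobolev k) :=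
  inferInstanceAs (AddCommGroup (π.sobolevSubmodule k))

instance (k : Fin ν → ℝ) : Module ℂ (π.Sobolev k) :=
  inferInstanceAs (Module ℂ (π.sobolevSubmodule k))

/-- The inclusion `H^k(π) ⊆ C^{-∞}(π)`. -/
def sobolevToDistr (k : Fin ν → ℝ) : π.Sobolev k →ₗ[ℂ] π.Distr := (π.sobolevSubmodule k).subtype

/-- The map `π_l(a) : H^k(π) → L²(π)` for `a` of order `l` with `Re l ≤ k`. -/
def sobolevToL2 {k : Fin ν → ℝ} {l : Fin ν → ℂ} (hl : ∀ i, (l i).re ≤ k i) (a : 𝒜.obj l) :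
    π.Sobolev k →ₗ[ℂ] π.L2 :=
  (LinearEquiv.ofInjective π.l2ToDistr π.l2ToDistr_injective).symm.toLinearMap ∘ₗ
    LinearMap.codRestrict (LinearMap.range π.l2ToDistr)
      ((π.distrAct a).toLinearMap ∘ₗ π.sobolevToDistr k) fun ξ => by
        obtain ⟨x, -, h⟩ := ξ.2
        obtain ⟨ζ, e, -⟩ := h l a hl
        exact ⟨ζ, e.symm⟩

theorem l2ToDistr_sobolevToL2 {k : Fin ν → ℝ} {l : Fin ν → ℂ} (hl : ∀ i, (l i).re ≤ k i)
    (a : 𝒜.obj l) (ξ : π.Sobolev k) :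
    π.l2ToDistr (π.sobolevToL2 hl a ξ) = π.distrAct a (π.sobolevToDistr k ξ) :=
  congrArg Subtype.val (LinearEquiv.apply_symm_apply
    (LinearEquiv.ofInjective π.l2ToDistr π.l2ToDistr_injective) _)

/-- The seminorm `ξ ↦ ‖π_l(a) ξ‖` on `H^k(π)`, for `a` of order `l` with `Re l ≤ k`. -/
def sobolevSeminorm (k : Fin ν → ℝ)
    (a : (l : {l : Fin ν → ℂ // ∀ i, (l i).re ≤ k i}) × 𝒜.obj l.1) :
    Seminorm ℂ (π.Sobolev k) :=
  (normSeminorm ℂ π.L2).comp (π.sobolevToL2 a.1.2 a.2)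

instance (k : Fin ν → ℝ) : UniformSpace (π.Sobolev k) :=
  uniformSpaceOfSeminorms (π.sobolevSeminorm k)

theorem distrAct_mem_sobolev {k : Fin ν → ℂ} (a : 𝒜.obj k) (l : Fin ν → ℝ) {ξ : π.Distr}
    (hξ : ξ ∈ π.sobolevSubmodule l) :
    π.distrAct a ξ ∈ π.sobolevSubmodule (fun i => l i - (k i).re) := by
  obtain ⟨x, hx, h⟩ := hξ
  refine ⟨fun n => π.smoothAct a (x n), ?_, fun m b hm => ?_⟩
  · simp_rw [← distrAct_l2ToDistr_smooth]
    exact ((π.distrAct a).continuous.tendsto ξ).comp hx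
  · obtain ⟨ζ, e, t⟩ := h (m + k) (𝒜.mul rfl b a) fun i => by
      have := hm i
      simp only [Pi.add_apply, Complex.add_re]
      linarith
    refine ⟨ζ, by rw [distrAct_distrAct π rfl, e], ?_⟩
    have e' : ∀ n, π.smoothAct b (π.smoothAct a (x n)) = π.smoothAct (𝒜.mul rfl b a) (x n) :=
      fun n => (LinearMap.congr_fun (π.act_mul rfl b a) (x n)).symm
    simp_rw [e']
    exact t

/-- The operator `π_k(a) : H^l(π) → H^{l - Re k}(π)`. -/
def sobolevAct {k : Fin ν → ℂ} (a : 𝒜.obj k) (l : Fin ν → ℝ) :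
    π.Sobolev l →ₗ[ℂ] π.Sobolev (fun i => l i - (k i).re) :=
  LinearMap.codRestrict (π.sobolevSubmodule fun i => l i - (k i).re)
    ((π.distrAct a).toLinearMap ∘ₗ π.sobolevToDistr l)
    fun ξ => π.distrAct_mem_sobolev a l ξ.2

/-- `π_k(a)` is a topological isomorphism of `C^{-∞}(π)`, from `H^l(π)` onto `H^{l - Re k}(π)` for
every `l`, and of `C^∞(π)`. -/
def ActsByTopIso {k : Fin ν → ℂ} (a : 𝒜.obj k) : Prop :=
  IsHomeomorph (π.distrAct a) ∧
  (∀ l : Fin ν → ℝ, IsHomeomorph (π.sobolevAct a l)) ∧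
  IsHomeomorph (π.smoothAct a)

end Rep

/-- `π_k(a)` and `π_{k̄}(a*)` are injective on `C^∞(π)` for all `π` in the set `S`. -/
def InjectiveOnSmooth {𝒜 : CStarCalculus.{u} ν} (S : Set (Rep.{u, w} 𝒜)) {k : Fin ν → ℂ}
    (a : 𝒜.obj k) : Prop :=
  ∀ π ∈ S, Function.Injective (π.smoothAct a) ∧ Function.Injective (π.smoothAct (𝒜.adj rfl a))

/-- The set `K` of all `k ∈ ℂ^ν` with at most one non-zero coordinate whose coordinates have real
and imaginary parts in `[-1, 1]`. -/
def orderCross (ν : ℕ) : Set (Fin ν → ℂ) :=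
  {k | (∀ i j, k i ≠ 0 → k j ≠ 0 → i = j) ∧
    ∀ i, (k i).re ∈ Set.Icc (-1 : ℝ) 1 ∧ (k i).im ∈ Set.Icc (-1 : ℝ) 1}

end CStarCalculus

end

/-! Non-invertibility is made visible in a representation where Fredholm theory is available. By
Krein-Milman and GNS, a proper left ideal of a unital C⋆-algebra kills a non-zero vector of some
irreducible representation (`exists_irreducibleRep_of_ne_top`). So if `x` is not invertible modulo a
⋆-ideal `I`, then `x` or `star x` has a kernel in an irreducible representation that kills `I`. This
representation may be taken from `S`, and Type I puts the compact operators into its image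
(`detectsInvertibility`). If `I` is chosen maximal among the ideals with a failure
(`exists_maximal_starIdeal`), then the elements acting compactly form a strictly larger ideal
(`lt_compactIdeal`). Maximality then makes the whole family under study Fredholm in that
representation. Index theory enters only through the operators of the form invertible plus compact
(`IsIndexZero`), a class that is preserved along Fredholm paths.

This mechanism is used twice. First, consider the path `v_{tk} a v_{-tk}` with `a` invertible modulo
an ideal and `k` small. In the representation found above the path starts at an invertible operator,
so all its operators have index zero. They are injective on `L²` because `v_m v_{-m}` is invertible
for small `m`. Hence they are invertible, a contradiction. So conjugation by `v_k` preserves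
invertibility, and sums of small orders give elements of every order with this property
(`IsContinuousFamily.hasTransport_all`).

Second, let `a` be self-adjoint of order zero and Fredholm. Then `a` and `e a e'` both have index
zero, and a dimension count shows that `e'` maps the kernel of `e a e'` onto the kernel of `a`
(`IsTransport.exists_eq_of_mem_ker`). As `e'` may have arbitrarily negative order, completeness of
`C^∞` makes the kernel smooth (`Rep.exists_smooth_of_forall`). Injectivity on smooth vectors
therefore forces invertibility (`isUnit_of_isSelfAdjoint`), and `a* a` yields (iii).

An injective `a` of order `k`, multiplied by an `e'` of order `-k`, gives units of order zero
(`IsInversePair`). The rest holds in every representation: with `e` of order `s`, the inverse of a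
unit `d` factors as `e' (e d e')⁻¹ e`, which yields smooth solutions and estimates, and `e`
identifies `H^s` with `L²`. -/

/-! ### Pure states and irreducible representations of C⋆-algebras -/

section PureStates

open scoped ComplexOrder

variable {B : Type u} [CStarAlgebra B]

/-- The states of a unital C⋆-algebra that vanish on a subspace, as a set of functions. -/
def statesVanishingOn (L : Submodule ℂ B) : Set (B → ℂ) :=
  {φ | (∀ x y, φ (x + y) = φ x + φ y) ∧ (∀ (r : ℂ) x, φ (r • x) = r * φ x) ∧
    (∀ x, ‖φ x‖ ≤ ‖x‖) ∧ φ 1 = 1 ∧ ∀ x ∈ L, φ x = 0}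

/-- All conditions are closed for pointwise convergence, and the norm bound confines the set to a
product of discs, so Tychonoff applies. -/
theorem isCompact_statesVanishingOn (L : Submodule ℂ B) : IsCompact (statesVanishingOn L) := by
  refine (isCompact_univ_pi fun x : B => isCompact_closedBall (0 : ℂ) ‖x‖).of_isClosed_subset ?_ ?_
  · simp only [statesVanishingOn, Set.ofPred_and, Set.ofPred_forall]
    refine IsClosed.inter ?_ (IsClosed.inter ?_ (IsClosed.inter ?_ (IsClosed.inter ?_ ?_)))
    · exact isClosed_iInter fun x => isClosed_iInter fun y => isClosed_eq (by fun_prop) (by fun_prop)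
    · exact isClosed_iInter fun x => isClosed_iInter fun y => isClosed_eq (by fun_prop) (by fun_prop)
    · exact isClosed_iInter fun x => isClosed_le (by fun_prop) (by fun_prop)
    · exact isClosed_eq (by fun_prop) (by fun_prop)
    · exact isClosed_iInter fun x => isClosed_iInter fun y => isClosed_eq (by fun_prop) (by fun_prop)
  · intro φ hφ x _
    simpa using hφ.2.2.1 x

/-- A proper left ideal contains no unit, hence stays at distance `1` from the unit element.
Hahn-Banach on the quotient then gives the functional. -/
theorem statesVanishingOn_nonempty (L : Ideal B) (hL : L ≠ ⊤) :
    (statesVanishingOn (L.restrictScalars ℂ)).Nonempty := by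
  have : Nontrivial B := ⟨0, 1, fun h => hL ((Ideal.eq_top_iff_one L).2 (h ▸ L.zero_mem))⟩
  let M : Submodule ℂ B := L.restrictScalars ℂ
  have h1 : ‖(Submodule.Quotient.mk 1 : B ⧸ M)‖ = 1 := by
    refine le_antisymm ((Submodule.Quotient.norm_mk_le M (1 : B)).trans CStarRing.norm_one.le) ?_
    refine (QuotientAddGroup.le_norm_iff (S := M.toAddSubgroup)).2 fun m hm => ?_
    by_contra! hlt
    have hmem : m - 1 ∈ M := (Submodule.Quotient.eq M).1 hm
    have hu : IsUnit (1 - m) := isUnit_one_sub_of_norm_lt_one hlt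
    refine hL (Ideal.eq_top_of_isUnit_mem L ?_ hu)
    have := M.neg_mem hmem
    rwa [neg_sub] at this
  obtain ⟨g, hg, hg1⟩ := exists_dual_vector'' ℂ (Submodule.Quotient.mk 1 : B ⧸ M)
  refine ⟨fun x => g (Submodule.Quotient.mk x), fun x y => by simp, fun r x => by simp,
    fun x => ?_, ?_, fun x hx => ?_⟩
  · refine (g.le_of_opNorm_le hg _).trans ?_
    rw [one_mul]
    exact Submodule.Quotient.norm_mk_le M x
  · simpa [h1] using hg1
  · change g (Submodule.Quotient.mk x) = 0
    rw [(Submodule.Quotient.mk_eq_zero M).2 hx, map_zero]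

/-- A functional of norm at most `1` with value `1` at the unit is real on self-adjoint elements. -/
theorem im_eq_zero_of_norm_le {φ : B →ₗ[ℂ] ℂ} (h : ∀ x, ‖φ x‖ ≤ ‖x‖) (h1 : φ 1 = 1) {x : B}
    (hx : IsSelfAdjoint x) : (φ x).im = 0 := by
  -- Evaluate at `x + i s`, whose squared norm is at most `‖x‖² + s²`. The left side grows by `2 s
  -- Im φ(x)`, so a suitable `s` rules out a non-zero imaginary part.
  have key : ∀ s : ℝ, ((φ x).im + s) ^ 2 ≤ ‖x‖ ^ 2 + s ^ 2 := fun s => by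
    have e : ‖x + ((s : ℂ) * Complex.I) • (1 : B)‖ ^ 2 ≤ ‖x‖ ^ 2 + s ^ 2 := by
      rw [sq, ← CStarRing.norm_star_mul_self]
      have : star (x + ((s : ℂ) * Complex.I) • (1 : B)) * (x + ((s : ℂ) * Complex.I) • (1 : B)) =
          x * x + ((s : ℂ) ^ 2) • (1 : B) := by
        simp only [star_add, star_smul, star_one, hx.star_eq, add_mul, mul_add, smul_mul_assoc,
          mul_smul_comm, one_mul, mul_one]
        simp only [star_mul', Complex.star_def, Complex.conj_ofReal, Complex.conj_I]
        have : (s : ℂ) * -Complex.I * (s * Complex.I) = (s : ℂ) ^ 2 := by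
          linear_combination (-(s : ℂ) ^ 2) * Complex.I_mul_I
        rw [← this]
        rw [mul_neg]
        module
      rw [this]
      refine (norm_add_le _ _).trans (add_le_add ((norm_mul_le _ _).trans (sq _).ge) ?_)
      rw [norm_smul]
      refine (mul_le_of_le_one_right (norm_nonneg _) ?_).trans ?_
      · rcases subsingleton_or_nontrivial B with hB | hB
        · simp [Subsingleton.elim (1 : B) 0]
        · exact CStarRing.norm_one.le
      · simp
    have e2 := h (x + ((s : ℂ) * Complex.I) • (1 : B))
    have e3 : ‖φ (x + ((s : ℂ) * Complex.I) • (1 : B))‖ ^ 2 ≤ ‖x‖ ^ 2 + s ^ 2 :=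
      (pow_le_pow_left₀ (norm_nonneg _) e2 2).trans e
    rw [map_add, map_smul, h1, smul_eq_mul, mul_one, Complex.sq_norm, Complex.normSq_apply] at e3
    simp at e3
    nlinarith [mul_self_nonneg (φ x).re]
  by_contra hne
  have h2 := key ((‖x‖ ^ 2 + 1) / (2 * (φ x).im))
  have : (φ x).im * ((‖x‖ ^ 2 + 1) / (2 * (φ x).im)) = (‖x‖ ^ 2 + 1) / 2 := by field_simp
  nlinarith [sq_nonneg (φ x).im]

/-- For `x ≥ 0` the element `‖x‖ - x` has norm at most `‖x‖`, so `φ x` lies in the disc of radius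
`‖x‖` about `‖x‖`. -/
theorem nonneg_of_norm_le [PartialOrder B] [StarOrderedRing B] {φ : B →ₗ[ℂ] ℂ}
    (h : ∀ x, ‖φ x‖ ≤ ‖x‖) (h1 : φ 1 = 1) {x : B} (hx : 0 ≤ x) : 0 ≤ φ x := by
  have him := im_eq_zero_of_norm_le h h1 hx.isSelfAdjoint
  rw [Complex.nonneg_iff]
  refine ⟨?_, him.symm⟩
  have e : ‖algebraMap ℝ B ‖x‖ - x‖ ≤ ‖x‖ := by
    rw [CStarAlgebra.norm_le_iff_le_algebraMap _ (norm_nonneg x)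
      (sub_nonneg.2 (IsSelfAdjoint.le_algebraMap_norm_self hx.isSelfAdjoint))]
    exact sub_le_self _ hx
  have e2 := (h _).trans e
  have e3 : φ (algebraMap ℝ B ‖x‖) = (‖x‖ : ℂ) := by
    rw [Algebra.algebraMap_eq_smul_one, ← Complex.coe_smul, map_smul, h1, smul_eq_mul, mul_one]
  rw [map_sub, e3] at e2
  have e4 := (Complex.abs_re_le_norm _).trans e2
  simp only [Complex.sub_re, Complex.ofReal_re] at e4
  have := (abs_le.1 e4).2
  linarith


/-- A state, as a positive linear functional. -/
theorem exists_positiveLinearMap [PartialOrder B] [StarOrderedRing B] {L : Submodule ℂ B}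
    {φ : B → ℂ} (hφ : φ ∈ statesVanishingOn L) : ∃ f : B →ₚ[ℂ] ℂ, ∀ x, f x = φ x := by
  let φ' : B →ₗ[ℂ] ℂ :=
    { toFun := φ
      map_add' := hφ.1
      map_smul' := hφ.2.1 }
  exact ⟨PositiveLinearMap.mk₀ φ' fun x hx => nonneg_of_norm_le hφ.2.2.1 hφ.2.2.2.1 hx,
    fun x => rfl⟩

/-- A vector functional of a representation, for a unit vector killed by `L`, is a state vanishing
on `L`. -/
theorem vectorState_mem {H : Type v} [NormedAddCommGroup H] [InnerProductSpace ℂ H]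
    [CompleteSpace H] (ρ : B →⋆ₐ[ℂ] (H →L[ℂ] H)) {L : Submodule ℂ B} {η : H} (hη : η ≠ 0)
    (hL : ∀ x ∈ L, ρ x η = 0) :
    (fun x => inner ℂ η (ρ x η) / (‖η‖ : ℂ) ^ 2) ∈ statesVanishingOn L := by
  have h0 : (‖η‖ : ℂ) ^ 2 ≠ 0 := by simpa using hη
  have h0' : 0 < ‖η‖ := norm_pos_iff.2 hη
  refine ⟨fun x y => ?_, fun r x => ?_, fun x => ?_, ?_, fun x hx => ?_⟩
  · simp [add_div]
  · simp [mul_div_assoc]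
  · rw [norm_div, norm_pow, Complex.norm_real, norm_norm, div_le_iff₀ (by positivity)]
    calc ‖inner ℂ η (ρ x η)‖ ≤ ‖η‖ * ‖ρ x η‖ := norm_inner_le_norm _ _
      _ ≤ ‖η‖ * (‖ρ x‖ * ‖η‖) := by gcongr; exact (ρ x).le_opNorm η
      _ ≤ ‖η‖ * (‖x‖ * ‖η‖) := by gcongr; exact NonUnitalStarAlgHom.norm_apply_le ρ x
      _ = ‖x‖ * ‖η‖ ^ 2 := by ring
  · simp [inner_self_eq_norm_sq_to_K, h0]
  · simp [hL x hx]

/-- The cyclic representation given by an extreme state that vanishes on `L` is irreducible. -/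
theorem isIrreducibleRep_of_extreme {H : Type v} [NormedAddCommGroup H] [InnerProductSpace ℂ H]
    [CompleteSpace H] (ρ : B →⋆ₐ[ℂ] (H →L[ℂ] H)) {L : Submodule ℂ B} {ξ : H} (hξ : ‖ξ‖ = 1)
    (hL : ∀ x ∈ L, ρ x ξ = 0) (hcyc : Dense (Set.range fun x => ρ x ξ))
    (hext : (fun x => inner ℂ ξ (ρ x ξ)) ∈ (statesVanishingOn L).extremePoints ℝ) :
    IsIrreducibleRep ρ := by
  have hξ0 : ξ ≠ 0 := fun h => by simp [h] at hξ
  refine ⟨⟨ξ, 0, hξ0⟩, fun M hM hinv => ?_⟩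
  have : CompleteSpace M := hM.completeSpace_coe
  let P : H →L[ℂ] H := M.starProjection
  have hinv' : ∀ b : B, ∀ η ∈ Mᗮ, ρ b η ∈ Mᗮ := fun b η hη => by
    rw [Submodule.mem_orthogonal] at hη ⊢
    intro u hu
    have := hη _ (hinv (star b) u hu)
    rwa [map_star, ContinuousLinearMap.star_eq_adjoint, ContinuousLinearMap.adjoint_inner_left]
      at this
  -- Since `M` and its orthogonal complement are both invariant, the projection commutes with the
  -- representation. In particular `P ξ` and `ξ - P ξ` are still killed by `L`.
  have hcomm : ∀ b η, P (ρ b η) = ρ b (P η) := fun b η => by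
    refine Submodule.eq_starProjection_of_mem_orthogonal (hinv b _ (M.starProjection_apply_mem η)) ?_
    rw [← map_sub]
    exact hinv' b _ (M.sub_starProjection_mem_orthogonal η)
  set η := P ξ with hηdef
  set ζ := ξ - η with hζdef
  have hηM : η ∈ M := M.starProjection_apply_mem ξ
  have hζM : ζ ∈ Mᗮ := M.sub_starProjection_mem_orthogonal ξ
  have dense_zero : ∀ T : H →L[ℂ] H, (∀ b, T (ρ b ξ) = 0) → T = 0 := fun T hT => by
    have : (T : H → H) = fun _ => 0 := by
      refine Continuous.ext_on hcyc T.continuous continuous_const ?_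
      rintro _ ⟨b, rfl⟩
      exact hT b
    ext x
    exact congrFun this x
  by_cases hη0 : η = 0
  · left
    have hP : P = 0 := dense_zero P fun b => by rw [hcomm, ← hηdef, hη0, map_zero]
    rw [Submodule.eq_bot_iff]
    intro x hx
    have : P x = x := Submodule.starProjection_eq_self_iff.2 hx
    rw [← this, hP]; rfl
  by_cases hζ0 : ζ = 0
  · right
    have hP : 1 - P = 0 := dense_zero (1 - P) fun b => by
      have : (1 - P) (ρ b ξ) = ρ b ξ - P (ρ b ξ) := rfl
      rw [this, hcomm, ← map_sub, ← hηdef, ← hζdef, hζ0, map_zero]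
    rw [Submodule.eq_top_iff']
    intro x
    have : (1 - P) x = 0 := by rw [hP]; rfl
    have hx : x = P x := sub_eq_zero.1 this
    rw [hx]
    exact M.starProjection_apply_mem x
  exfalso
  have hLη : ∀ x ∈ L, ρ x η = 0 := fun x hx => by rw [hηdef, ← hcomm, hL x hx, map_zero]
  have hLζ : ∀ x ∈ L, ρ x ζ = 0 := fun x hx => by rw [hζdef, map_sub, hL x hx, hLη x hx, sub_zero]
  have hsum : ξ = η + ζ := by rw [hζdef]; abel
  have horth : ∀ u ∈ M, ∀ w ∈ Mᗮ, inner ℂ u w = 0 := fun u hu w hw =>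
    (Submodule.mem_orthogonal M w).1 hw u hu
  have horth' : ∀ u ∈ M, ∀ w ∈ Mᗮ, inner ℂ w u = 0 := fun u hu w hw =>
    (Submodule.mem_orthogonal' M w).1 hw u hu
  have hnorm : ‖η‖ ^ 2 + ‖ζ‖ ^ 2 = 1 := by
    have := norm_add_sq_eq_norm_sq_add_norm_sq_of_inner_eq_zero η ζ (horth _ hηM _ hζM)
    rw [← hsum, hξ] at this
    nlinarith
  have hη1 : 0 < ‖η‖ := norm_pos_iff.2 hη0
  have hζ1 : 0 < ‖ζ‖ := norm_pos_iff.2 hζ0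
  -- The state of `ξ` is the convex combination of the states of `η` and `ζ` with weights `‖η‖²` and
  -- `‖ζ‖²`; extremality makes it equal to the state of `η`.
  have heq := hext.2 (vectorState_mem ρ hη0 hLη) (vectorState_mem ρ hζ0 hLζ)
    ⟨‖η‖ ^ 2, ‖ζ‖ ^ 2, by positivity, by positivity, hnorm, by
      funext x
      have h1 : (‖η‖ : ℂ) ≠ 0 := by exact_mod_cast hη1.ne'
      have h2 : (‖ζ‖ : ℂ) ≠ 0 := by exact_mod_cast hζ1.ne'
      simp only [Pi.add_apply, Pi.smul_apply, Complex.real_smul]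
      push_cast
      rw [mul_div_cancel₀ _ (pow_ne_zero 2 h1), mul_div_cancel₀ _ (pow_ne_zero 2 h2)]
      conv_rhs => rw [hsum]
      rw [map_add, inner_add_left, inner_add_right, inner_add_right,
        horth _ hηM _ (hinv' x _ hζM), horth' _ (hinv x _ hηM) _ hζM]
      ring⟩
  -- Equality of the two states says that this vector is orthogonal to the dense orbit of `ξ`.
  -- Applying `P` then forces `‖η‖ = 1`, against `ζ ≠ 0`.
  have hvec : η - ((‖η‖ : ℂ) ^ 2) • ξ = 0 := by
    have hall : ∀ x, inner ℂ (ρ x ξ) (η - ((‖η‖ : ℂ) ^ 2) • ξ) = 0 := fun x => by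
      have h1 := congrFun heq (star x)
      have h0 : (‖η‖ : ℂ) ^ 2 ≠ 0 := by simpa using hη0
      rw [div_eq_iff h0, map_star, ContinuousLinearMap.star_eq_adjoint,
        ContinuousLinearMap.adjoint_inner_right, ContinuousLinearMap.adjoint_inner_right] at h1
      have h2 : inner ℂ (ρ x ξ) η = inner ℂ (ρ x η) η := by
        conv_lhs => rw [hsum]
        rw [map_add, inner_add_left, horth' _ hηM _ (hinv' x _ hζM), add_zero]
      rw [inner_sub_right, inner_smul_right, h2, h1]
      ring
    have hz : ∀ y, inner ℂ y (η - ((‖η‖ : ℂ) ^ 2) • ξ) = 0 := fun y => by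
      have := Continuous.ext_on hcyc (f := fun y => inner ℂ y (η - ((‖η‖ : ℂ) ^ 2) • ξ))
        (g := fun _ => 0) (by fun_prop) continuous_const (by rintro _ ⟨b, rfl⟩; exact hall b)
      exact congrFun this y
    exact inner_self_eq_zero.1 (hz _)
  have hPη : P η = η := Submodule.starProjection_eq_self_iff.2 hηM
  have h3 : η - ((‖η‖ : ℂ) ^ 2) • η = 0 := by
    have := congrArg P hvec
    rwa [map_sub, map_smul, hPη, ← hηdef, map_zero] at this
  have h4 : (1 - (‖η‖ : ℂ) ^ 2) • η = 0 := by rw [sub_smul, one_smul, h3]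
  rcases smul_eq_zero.1 h4 with h5 | h5
  · have h6 : ‖η‖ ^ 2 = 1 := by
      have : (‖η‖ : ℂ) ^ 2 = 1 := (sub_eq_zero.1 h5).symm
      exact_mod_cast this
    have : 0 < ‖ζ‖ ^ 2 := by positivity
    linarith
  · exact hη0 h5

/-- Every proper left ideal of a unital C⋆-algebra kills a non-zero vector of an irreducible
representation. -/
theorem exists_irreducibleRep_of_ne_top (L : Ideal B) (hL : L ≠ ⊤) :
    ∃ (H : Type u) (_ : NormedAddCommGroup H) (_ : InnerProductSpace ℂ H) (_ : CompleteSpace H)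
      (ρ : B →⋆ₐ[ℂ] (H →L[ℂ] H)), IsIrreducibleRep ρ ∧ ∃ ξ : H, ξ ≠ 0 ∧ ∀ x ∈ L, ρ x ξ = 0 := by
  let := CStarAlgebra.spectralOrder B
  have := CStarAlgebra.spectralOrderedRing B
  obtain ⟨φ, hφ⟩ := (isCompact_statesVanishingOn (L.restrictScalars ℂ)).extremePoints_nonempty
    (statesVanishingOn_nonempty L hL)
  obtain ⟨f, hf⟩ := exists_positiveLinearMap hφ.1
  have hfφ : φ = f := (funext hf).symm
  let ξ : f.GNS := (f.toPreGNS 1 : f.PreGNS)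
  have happ : ∀ x, f.gnsStarAlgHom x ξ = (f.toPreGNS x : f.PreGNS) := fun x => by
    have := f.gnsNonUnitalStarAlgHom_apply_coe (a := x) (b := f.toPreGNS 1)
    refine this.trans ?_
    simp
  have hinner : ∀ x, inner ℂ ξ (f.gnsStarAlgHom x ξ) = f x := fun x => by
    rw [happ, Completion.inner_coe, PositiveLinearMap.preGNS_inner_def]
    simp
  have hξ : ‖ξ‖ = 1 := by
    have h := hinner 1
    rw [map_one, one_apply_eq_self, hf, hφ.1.2.2.2.1, inner_self_eq_norm_sq_to_K] at h
    have h' : ((‖ξ‖ ^ 2 : ℝ) : ℂ) = 1 := by simpa using h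
    have h'' : ‖ξ‖ ^ 2 = 1 := by exact_mod_cast h'
    nlinarith [norm_nonneg ξ]
  -- In the GNS space `‖x ξ‖² = φ(x* x)`, and `x* x` lies in the left ideal.
  have hkill : ∀ x ∈ L, f.gnsStarAlgHom x ξ = 0 := fun x hx => by
    rw [happ, ← norm_eq_zero, Completion.norm_coe, ← sq_eq_zero_iff]
    have := f.preGNS_norm_sq (f.toPreGNS x)
    rw [PositiveLinearMap.ofPreGNS_toPreGNS, hf, hφ.1.2.2.2.2 _ (L.mul_mem_left _ hx)] at this
    exact_mod_cast this
  have hcyc : Dense (Set.range fun x => f.gnsStarAlgHom x ξ) := by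
    have : (Set.range fun x => f.gnsStarAlgHom x ξ) =
        Set.range ((↑) : f.PreGNS → f.GNS) := by
      ext y
      constructor
      · rintro ⟨x, rfl⟩; exact ⟨f.toPreGNS x, (happ x).symm⟩
      · rintro ⟨x, rfl⟩; exact ⟨f.ofPreGNS x, happ _⟩
    rw [this]
    exact Completion.denseRange_coe
  refine ⟨f.GNS, inferInstance, inferInstance, inferInstance, f.gnsStarAlgHom,
    isIrreducibleRep_of_extreme _ (L := L.restrictScalars ℂ) hξ hkill hcyc ?_, ξ, ?_, hkill⟩
  · have : (fun x => inner ℂ ξ (f.gnsStarAlgHom x ξ)) = φ := by rw [hfφ]; exact funext hinner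
    rw [this]
    exact hφ
  · intro h; simp [h] at hξ

end PureStates

/-! ### Invertibility modulo ideals -/

section InvertibleModulo

variable {B : Type u} [CStarAlgebra B]

/-- A left ideal that is two-sided and closed under the involution. -/
def IsStarIdeal (I : Ideal B) : Prop :=
  (∀ x ∈ I, ∀ b, x * b ∈ I) ∧ ∀ x ∈ I, star x ∈ I

theorem isStarIdeal_bot : IsStarIdeal (⊥ : Ideal B) := by
  constructor <;> simp +contextual

/-- Invertibility modulo a (two-sided) ideal. -/
def InvertibleMod (I : Ideal B) (x : B) : Prop :=
  ∃ b, b * x - 1 ∈ I ∧ x * b - 1 ∈ I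

theorem invertibleMod_bot {x : B} : InvertibleMod ⊥ x ↔ IsUnit x := by
  constructor
  · rintro ⟨b, h1, h2⟩
    rw [Ideal.mem_bot, sub_eq_zero] at h1 h2
    exact ⟨⟨x, b, h2, h1⟩, rfl⟩
  · rintro ⟨y, rfl⟩
    exact ⟨↑y⁻¹, by simp, by simp⟩

theorem InvertibleMod.mono {I J : Ideal B} (h : I ≤ J) {x : B} (hx : InvertibleMod I x) :
    InvertibleMod J x := by
  obtain ⟨b, h1, h2⟩ := hx
  exact ⟨b, h h1, h h2⟩

theorem InvertibleMod.of_left_right {I : Ideal B} (hI : IsStarIdeal I) {x b c : B}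
    (hb : b * x - 1 ∈ I) (hc : x * c - 1 ∈ I) : InvertibleMod I x := by
  have h : b - c ∈ I := by
    have : b - c = (b * x - 1) * c - b * (x * c - 1) := by noncomm_ring
    rw [this]
    exact I.sub_mem (hI.1 _ hb c) (I.mul_mem_left b hc)
  refine ⟨b, hb, ?_⟩
  have : x * b - 1 = x * (b - c) + (x * c - 1) := by noncomm_ring
  rw [this]
  exact I.add_mem (I.mul_mem_left x h) hc

theorem InvertibleMod.star {I : Ideal B} (hI : IsStarIdeal I) {x : B} (hx : InvertibleMod I x) :
    InvertibleMod I (star x) := by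
  obtain ⟨b, hb1, hb2⟩ := hx
  exact ⟨Star.star b, by simpa using hI.2 _ hb2, by simpa using hI.2 _ hb1⟩

theorem invertibleMod_star_iff {I : Ideal B} (hI : IsStarIdeal I) {x : B} :
    InvertibleMod I (star x) ↔ InvertibleMod I x :=
  ⟨fun h => by simpa using h.star hI, fun h => h.star hI⟩

/-- If `b` inverts `x` modulo `I`, then `b y` is congruent to `1 + b (y - x)`, a unit for `y` near
`x`. The ideal need not be closed. -/
theorem InvertibleMod.eventually {I : Ideal B} (hI : IsStarIdeal I) {x : B}
    (hx : InvertibleMod I x) : ∀ᶠ y in 𝓝 x, InvertibleMod I y := by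
  obtain ⟨b, hb1, hb2⟩ := hx
  have h1 : ∀ᶠ y in 𝓝 x, IsUnit (1 + b * (y - x)) := by
    refine Units.isOpen.mem_nhds ?_ |> (Continuous.continuousAt (by fun_prop : Continuous
      fun y => 1 + b * (y - x))).preimage_mem_nhds
    simp
  have h2 : ∀ᶠ y in 𝓝 x, IsUnit (1 + (y - x) * b) := by
    refine Units.isOpen.mem_nhds ?_ |> (Continuous.continuousAt (by fun_prop : Continuous
      fun y => 1 + (y - x) * b)).preimage_mem_nhds
    simp
  filter_upwards [h1, h2] with y ⟨u, hu⟩ ⟨u', hu'⟩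
  refine InvertibleMod.of_left_right hI (b := ↑u⁻¹ * b) (c := b * ↑u'⁻¹) ?_ ?_
  · have : (↑u⁻¹ : B) * b * y - 1 = ↑u⁻¹ * (b * x - 1) + (↑u⁻¹ * (1 + b * (y - x)) - 1) := by
      noncomm_ring
    rw [this, ← hu, Units.inv_mul, sub_self, add_zero]
    exact I.mul_mem_left _ hb1
  · have : y * (b * (↑u'⁻¹ : B)) - 1 =
        (x * b - 1) * ↑u'⁻¹ + ((1 + (y - x) * b) * ↑u'⁻¹ - 1) := by
      noncomm_ring
    rw [this, ← hu', Units.mul_inv, sub_self, add_zero]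
    exact hI.1 _ hb2 _

/-- If a compact family contains an element that is not invertible modulo `J`, then there is a
maximal ideal with this property above `J`. -/
theorem exists_maximal_starIdeal {X : Type*} [TopologicalSpace X] {T : Set X} (hT : IsCompact T)
    {f : X → B} (hf : ContinuousOn f T) {J : Ideal B} (hJ : IsStarIdeal J)
    (h : ∃ t ∈ T, ¬ InvertibleMod J (f t)) :
    ∃ I : Ideal B, IsStarIdeal I ∧ J ≤ I ∧ (∃ t ∈ T, ¬ InvertibleMod I (f t)) ∧
      ∀ I' : Ideal B, IsStarIdeal I' → I < I' → ∀ t ∈ T, InvertibleMod I' (f t) := by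
  let 𝒮 : Set (Ideal B) := {I | IsStarIdeal I ∧ ∃ t ∈ T, ¬ InvertibleMod I (f t)}
  obtain ⟨I, hJI, hI⟩ := zorn_le_nonempty₀ 𝒮 (fun c hc hchain I₀ hI₀ => by
    have hne : c.Nonempty := ⟨I₀, hI₀⟩
    have hdir : DirectedOn (· ≤ ·) c := hchain.directedOn
    -- Ideals are not required to be closed, so the supremum of a chain is its plain union.
    have hmem : ∀ x, x ∈ sSup c ↔ ∃ I ∈ c, x ∈ I := fun x =>
      Submodule.mem_sSup_of_directed hne hdir
    have hstar : IsStarIdeal (sSup c) := by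
      constructor
      · intro x hx b
        obtain ⟨I, hI, hxI⟩ := (hmem x).1 hx
        exact (hmem _).2 ⟨I, hI, (hc hI).1.1 x hxI b⟩
      · intro x hx
        obtain ⟨I, hI, hxI⟩ := (hmem x).1 hx
        exact (hmem _).2 ⟨I, hI, (hc hI).1.2 x hxI⟩
    refine ⟨sSup c, ⟨hstar, ?_⟩, fun I hI => le_sSup hI⟩
    by_contra! hall
    -- Invertibility at one `t` amounts to two membership relations, so it already holds modulo a
    -- member of the chain and persists near `t`. Compactness then gives one member for all `t`.
    have : ∃ I ∈ c, ∀ t ∈ T, InvertibleMod I (f t) := by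
      refine hT.induction_on (p := fun s => ∃ I ∈ c, ∀ t ∈ s, InvertibleMod I (f t))
        ⟨I₀, hI₀, by simp⟩ (fun s s' hss ⟨I, hI, h⟩ => ⟨I, hI, fun t ht => h t (hss ht)⟩)
        ?_ ?_
      · rintro s s' ⟨I, hI, h⟩ ⟨I', hI', h'⟩
        obtain ⟨I'', hI'', h1, h2⟩ := hdir I hI I' hI'
        exact ⟨I'', hI'', fun t ht => ht.elim (fun ht => (h t ht).mono h1)
          fun ht => (h' t ht).mono h2⟩
      · intro t ht
        obtain ⟨b, hb1, hb2⟩ := hall t ht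
        obtain ⟨I, hI, h1⟩ := (hmem _).1 hb1
        obtain ⟨I', hI', h2⟩ := (hmem _).1 hb2
        obtain ⟨I'', hI'', h3, h4⟩ := hdir I hI I' hI'
        have hinv : InvertibleMod I'' (f t) := ⟨b, h3 h1, h4 h2⟩
        exact ⟨_, (hf t ht).eventually (hinv.eventually (hc hI'').1), I'', hI'', fun s hs => hs⟩
    obtain ⟨I, hI, hI'⟩ := this
    obtain ⟨t, ht, hnot⟩ := (hc hI).2
    exact hnot (hI' t ht)) J ⟨hJ, h⟩
  refine ⟨I, hI.1.1, hJI, hI.1.2, fun I' hI' hlt t ht => ?_⟩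
  by_contra hnot
  exact hlt.not_ge (hI.2 ⟨hI', t, ht, hnot⟩ hlt.le)

/-- An element that is not invertible modulo an ideal has, up to taking adjoints, a kernel in an
irreducible representation that kills the ideal. -/
theorem exists_irreducibleRep_of_not_invertibleMod {I : Ideal B} (hI : IsStarIdeal I) {x : B}
    (hx : ¬ InvertibleMod I x) :
    ∃ (H : Type u) (_ : NormedAddCommGroup H) (_ : InnerProductSpace ℂ H) (_ : CompleteSpace H)
      (ρ : B →⋆ₐ[ℂ] (H →L[ℂ] H)), IsIrreducibleRep ρ ∧ (∀ y ∈ I, ρ y = 0) ∧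
        ∃ ξ : H, ξ ≠ 0 ∧ (ρ x ξ = 0 ∨ ρ (star x) ξ = 0) := by
  have key : ∀ z : B, (¬ ∃ b, b * z - 1 ∈ I) →
      ∃ (H : Type u) (_ : NormedAddCommGroup H) (_ : InnerProductSpace ℂ H) (_ : CompleteSpace H)
      (ρ : B →⋆ₐ[ℂ] (H →L[ℂ] H)), IsIrreducibleRep ρ ∧ (∀ y ∈ I, ρ y = 0) ∧
        ∃ ξ : H, ξ ≠ 0 ∧ ρ z ξ = 0 := by
    intro z hz
    -- The left ideal generated by `z` and `I` is proper exactly because `z` has no left inverse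
    -- modulo `I`.
    have hne : Ideal.span {z} ⊔ I ≠ ⊤ := by
      rw [Ne, Ideal.eq_top_iff_one, Submodule.mem_sup]
      rintro ⟨y, hy, i, hi, hsum⟩
      obtain ⟨b, rfl⟩ := Ideal.mem_span_singleton'.1 hy
      refine hz ⟨b, ?_⟩
      rw [← hsum, sub_add_cancel_left]
      exact I.neg_mem hi
    obtain ⟨H, i1, i2, i3, ρ, hρ, ξ, hξ, hkill⟩ := exists_irreducibleRep_of_ne_top _ hne
    refine ⟨H, i1, i2, i3, ρ, hρ, ?_, ξ, hξ,
      hkill z (Ideal.mem_sup_left (Ideal.mem_span_singleton_self z))⟩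
    -- The vectors killed by `I` form a closed subspace, invariant as `I` is two-sided. It contains
    -- `ξ`, so by irreducibility `I` kills everything.
    let M : Submodule ℂ H := ⨅ y : I, LinearMap.ker (ρ y : H →ₗ[ℂ] H)
    have hmem : ∀ η, η ∈ M ↔ ∀ y ∈ I, ρ y η = 0 := fun η => by
      simp [M, Submodule.mem_iInf]
    have hM : IsClosed (M : Set H) := by
      have : (M : Set H) = ⋂ y ∈ I, {η | ρ y η = 0} := by
        ext η
        simp [hmem]
      rw [this]
      exact isClosed_biInter fun y _ => isClosed_eq (by fun_prop) (by fun_prop)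
    have htop : M = ⊤ := by
      refine (hρ.2 M hM fun b η hη => ?_).resolve_left fun hbot => ?_
      · rw [hmem] at hη ⊢
        intro y hy
        have := hη _ (hI.1 y hy b)
        rwa [map_mul] at this
      · have : ξ ∈ M := (hmem ξ).2 fun y hy => hkill y (Ideal.mem_sup_right hy)
        rw [hbot] at this
        exact hξ this
    intro y hy
    ext η
    exact (hmem η).1 (htop ▸ Submodule.mem_top) y hy
  by_cases h1 : ∃ b, b * x - 1 ∈ I
  · have h2 : ¬ ∃ b, b * star x - 1 ∈ I := by
      rintro ⟨c, hc⟩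
      obtain ⟨b, hb⟩ := h1
      exact hx (.of_left_right hI hb (c := star c) (by simpa using hI.2 _ hc))
    obtain ⟨H, i1, i2, i3, ρ, hρ, hk, ξ, hξ, h⟩ := key _ h2
    exact ⟨H, i1, i2, i3, ρ, hρ, hk, ξ, hξ, .inr h⟩
  · obtain ⟨H, i1, i2, i3, ρ, hρ, hk, ξ, hξ, h⟩ := key _ h1
    exact ⟨H, i1, i2, i3, ρ, hρ, hk, ξ, hξ, .inl h⟩

end InvertibleModulo

/-! ### Compact perturbations of invertible operators -/

section IndexZero

variable {H : Type v} [NormedAddCommGroup H] [InnerProductSpace ℂ H]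

/-- Invertible operators plus compact operators. -/
def IsIndexZero (T : H →L[ℂ] H) : Prop :=
  ∃ U : H →L[ℂ] H, IsUnit U ∧ IsCompactOperator (T - U)

theorem IsUnit.isIndexZero {T : H →L[ℂ] H} (hT : IsUnit T) : IsIndexZero T :=
  ⟨T, hT, by rw [sub_self]; exact isCompactOperator_zero⟩

theorem IsCompactOperator.mul_left {T : H →L[ℂ] H} (hT : IsCompactOperator T) (S : H →L[ℂ] H) :
    IsCompactOperator (S * T) := hT.clm_comp S

theorem IsCompactOperator.mul_right {T : H →L[ℂ] H} (hT : IsCompactOperator T) (S : H →L[ℂ] H) :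
    IsCompactOperator (T * S) := hT.comp_clm S

theorem IsIndexZero.of_sub {T T' : H →L[ℂ] H} (hT : IsIndexZero T)
    (h : IsCompactOperator (T' - T)) : IsIndexZero T' := by
  obtain ⟨U, hU, hK⟩ := hT
  refine ⟨U, hU, ?_⟩
  rw [← sub_add_sub_cancel T' T U]
  exact IsCompactOperator.add h hK

theorem IsIndexZero.mul {S T : H →L[ℂ] H} (hS : IsIndexZero S) (hT : IsIndexZero T) :
    IsIndexZero (S * T) := by
  obtain ⟨U, hU, hK⟩ := hS
  obtain ⟨V, hV, hL⟩ := hT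
  refine ⟨U * V, hU.mul hV, ?_⟩
  have : S * T - U * V = (S - U) * T + U * (T - V) := by noncomm_ring
  rw [this]
  exact IsCompactOperator.add (hK.mul_right T) (hL.mul_left U)

/-- On the kernel of `T` the compact operator `U⁻¹ (U - T)` is the identity, so Riesz's theorem
applies. -/
theorem IsIndexZero.finiteDimensional_ker {T : H →L[ℂ] H} (hT : IsIndexZero T) :
    FiniteDimensional ℂ (LinearMap.ker (T : H →ₗ[ℂ] H)) := by
  obtain ⟨U, ⟨U, rfl⟩, hK⟩ := hT
  let C : H →L[ℂ] H := (U⁻¹ : (H →L[ℂ] H)ˣ) * (U - T)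
  have hC : IsCompactOperator C := by
    refine IsCompactOperator.mul_left ?_ _
    rw [← neg_sub T]
    exact IsCompactOperator.neg hK
  set N := LinearMap.ker (T : H →ₗ[ℂ] H)
  have hCx : ∀ x ∈ N, C x = x := fun x hx => by
    have hx' : T x = 0 := hx
    change (U⁻¹ : (H →L[ℂ] H)ˣ).1 (U.1 x - T x) = x
    rw [hx', sub_zero]
    exact DFunLike.congr_fun U.inv_mul x
  have hr := hC.restrict (f := (C : H →ₗ[ℂ] H)) (V := N)
    (fun x hx => by rw [ContinuousLinearMap.coe_coe, hCx x hx]; exact hx)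
    (ContinuousLinearMap.isClosed_ker T)
  refine FiniteDimensional.of_isCompactOperator_id (𝕜 := ℂ) (E := N) ?_
  have e : ((C : H →ₗ[ℂ] H).restrict fun x hx => by
      rw [ContinuousLinearMap.coe_coe, hCx x hx]; exact hx : N → N) = id := by
    funext x
    exact Subtype.ext (hCx x x.2)
  rwa [e] at hr

variable [CompleteSpace H]

/-- Keep the compact part fixed and perturb the invertible part. -/
theorem isOpen_isIndexZero : IsOpen {T : H →L[ℂ] H | IsIndexZero T} := by
  rw [isOpen_iff_mem_nhds]
  rintro T ⟨U, hU, hK⟩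
  have h : ∀ᶠ T' in 𝓝 T, IsUnit (T' - (T - U)) :=
    (Continuous.continuousAt (by fun_prop : Continuous fun T' => T' - (T - U))).preimage_mem_nhds
      (Units.isOpen.mem_nhds (by simpa using hU))
  filter_upwards [h] with T' hT'
  exact ⟨_, hT', by rwa [sub_sub_cancel]⟩

/-- A limit of operators of index zero is of index zero if it is invertible modulo compact
operators. -/
theorem IsIndexZero.of_mem_closure {S T : H →L[ℂ] H}
    (hT : T ∈ closure {T : H →L[ℂ] H | IsIndexZero T}) (hST : IsCompactOperator (S * T - 1 : H →L[ℂ] H))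
    (hTS : IsCompactOperator (T * S - 1 : H →L[ℂ] H)) : IsIndexZero T := by
  have h : ∀ᶠ T' in 𝓝 T, IsUnit (1 + S * (T' - T)) :=
    (Continuous.continuousAt (by fun_prop : Continuous
      fun T' => 1 + S * (T' - T))).preimage_mem_nhds (Units.isOpen.mem_nhds (by simp))
  obtain ⟨T', hT', hu⟩ := mem_closure_iff_frequently.1 hT |>.and_eventually h |>.exists
  obtain ⟨U, ⟨U, rfl⟩, hK⟩ := hT'
  obtain ⟨V, hV⟩ := hu
  -- Modulo compact operators `S U = S T' = 1 + S (T' - T) = V`, so the parametrix `S` is an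
  -- invertible operator up to compacts, and `T` is congruent to the inverse of that operator.
  have hS : IsCompactOperator (S - (V * U⁻¹ : (H →L[ℂ] H)ˣ).1) := by
    have e : S - (V * U⁻¹ : (H →L[ℂ] H)ˣ) = (S * U - V) * (U⁻¹ : (H →L[ℂ] H)ˣ) := by
      rw [sub_mul, mul_assoc, Units.mul_inv, mul_one, Units.val_mul]
    rw [e]
    refine IsCompactOperator.mul_right ?_ _
    have e : S * U - V = (S * T - 1) - S * (T' - U) := by rw [hV]; noncomm_ring
    rw [e]
    exact IsCompactOperator.sub hST (hK.mul_left S)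
  refine ⟨((V * U⁻¹)⁻¹ : (H →L[ℂ] H)ˣ), Units.isUnit _, ?_⟩
  set W := V * U⁻¹
  have e : T - (W⁻¹ : (H →L[ℂ] H)ˣ) = ((T * S - 1) - T * (S - W)) * (W⁻¹ : (H →L[ℂ] H)ˣ) := by
    have : (T * S - 1) - T * (S - W) = T * W - 1 := by noncomm_ring
    rw [this, sub_mul, mul_assoc, Units.mul_inv, mul_one, one_mul]
  rw [e]
  exact IsCompactOperator.mul_right (IsCompactOperator.sub hTS (hS.mul_left T)) _

/-- Along a path of operators that are invertible modulo compact operators, index zero is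
preserved. -/
theorem IsIndexZero.of_path {F : ℝ → H →L[ℂ] H} (hF : ContinuousOn F (Set.Icc 0 1))
    (hinv : ∀ t ∈ Set.Icc (0 : ℝ) 1, ∃ S : H →L[ℂ] H,
      IsCompactOperator (S * F t - 1 : H →L[ℂ] H) ∧ IsCompactOperator (F t * S - 1 : H →L[ℂ] H)) (h0 : IsIndexZero (F 0)) {t : ℝ}
    (ht : t ∈ Set.Icc (0 : ℝ) 1) : IsIndexZero (F t) := by
  let G : Set.Icc (0 : ℝ) 1 → H →L[ℂ] H := fun s => F s
  have hG : Continuous G := continuousOn_iff_continuous_domRestrict.1 hF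
  -- Index zero is an open condition, and a closed one along Fredholm operators; the interval is
  -- connected.
  have hclopen : IsClopen (G ⁻¹' {T | IsIndexZero T}) := by
    refine ⟨?_, isOpen_isIndexZero.preimage hG⟩
    refine isClosed_of_closure_subset fun s hs => ?_
    obtain ⟨S, h1, h2⟩ := hinv s s.2
    exact IsIndexZero.of_mem_closure (hG.closure_preimage_subset _ hs) h1 h2
  have := hclopen.eq_univ ⟨⟨0, by simp⟩, h0⟩
  have hmem : (⟨t, ht⟩ : Set.Icc (0 : ℝ) 1) ∈ G ⁻¹' {T | IsIndexZero T} := this ▸ Set.mem_univ _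
  exact hmem

/-- The Fredholm alternative. -/
theorem IsIndexZero.isUnit {T : H →L[ℂ] H} (hT : IsIndexZero T) (hinj : ∀ x, T x = 0 → x = 0) :
    IsUnit T := by
  obtain ⟨U, ⟨U, rfl⟩, hK⟩ := hT
  let C : H →L[ℂ] H := (U⁻¹ : (H →L[ℂ] H)ˣ) * (U - T)
  have hC : IsCompactOperator C := by
    refine IsCompactOperator.mul_left ?_ _
    rw [← neg_sub T]
    exact IsCompactOperator.neg hK
  have hT : T = U * (1 - C) := by
    simp only [C, mul_sub, mul_one, ← mul_assoc, Units.mul_inv, one_mul, sub_sub_cancel]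
  rcases hC.hasEigenvalue_or_mem_resolventSet (one_ne_zero (α := ℂ)) with h | h
  · obtain ⟨x, hx⟩ := h.exists_hasEigenvector
    refine absurd (hinj x ?_) hx.2
    have : C x = x := by simpa using hx.apply_eq_smul
    rw [hT]
    change (U : H →L[ℂ] H) (x - C x) = 0
    rw [this, sub_self, map_zero]
  · rw [hT]
    refine U.isUnit.mul ?_
    have := spectrum.mem_resolventSet_iff.1 h
    rwa [map_one] at this

/-- For an operator of index zero the cokernel is not larger than the kernel. -/
theorem IsIndexZero.finrank_orthogonal_range_le {T : H →L[ℂ] H} (hT : IsIndexZero T) :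
    FiniteDimensional ℂ (LinearMap.range (T : H →ₗ[ℂ] H))ᗮ ∧
    Module.finrank ℂ (LinearMap.range (T : H →ₗ[ℂ] H))ᗮ ≤
      Module.finrank ℂ (LinearMap.ker (T : H →ₗ[ℂ] H)) := by
  have := hT.finiteDimensional_ker
  set N := LinearMap.ker (T : H →ₗ[ℂ] H)
  set R := LinearMap.range (T : H →ₗ[ℂ] H)
  -- Adding `j` composed with the projection onto the kernel is a compact perturbation that makes
  -- `T` injective. By the Fredholm alternative the sum is onto, so `j` must fill the whole
  -- cokernel.
  have key : ∀ j : N →ₗ[ℂ] Rᗮ, Function.Injective j → Function.Surjective j := by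
    intro j hj
    let F : H →L[ℂ] H := Rᗮ.subtypeL ∘L LinearMap.toContinuousLinearMap j ∘L N.orthogonalProjectionOnto
    have hFR : ∀ x, F x ∈ Rᗮ := fun x => (j (N.orthogonalProjectionOnto x)).2
    have hFK : IsCompactOperator F :=
      (isCompactOperator_of_locallyCompactSpace_rng
        (Rᗮ.subtypeL ∘L LinearMap.toContinuousLinearMap j)).comp_clm N.orthogonalProjectionOnto
    have hdisj : ∀ x ∈ R, x ∈ Rᗮ → x = 0 := fun x h1 h2 => by
      exact inner_self_eq_zero.1 ((Submodule.mem_orthogonal R x).1 h2 x h1)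
    have hTR : ∀ x, T x ∈ R := fun x => ⟨x, rfl⟩
    have hunit : IsUnit (T + F) := by
      refine (hT.of_sub (by rwa [add_sub_cancel_left])).isUnit fun x hx => ?_
      have hx' : T x + F x = 0 := hx
      have h1 : T x = 0 := by
        refine hdisj _ (hTR x) ?_
        rw [eq_neg_of_add_eq_zero_left hx']
        exact Rᗮ.neg_mem (hFR x)
      have hxN : x ∈ N := h1
      rw [h1, zero_add] at hx'
      have h2 : j (N.orthogonalProjectionOnto x) = 0 := Subtype.ext hx'
      have h3 := (map_eq_zero_iff j hj).1 h2
      have h4 := Submodule.orthogonalProjectionOnto_mem_subspace_eq_self (K := N) ⟨x, hxN⟩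
      rw [h3] at h4
      exact (congrArg Subtype.val h4).symm
    intro y
    obtain ⟨x, hx⟩ := (ContinuousLinearMap.isUnit_iff_bijective.1 hunit).2 y
    have hx' : T x + F x = y := hx
    refine ⟨N.orthogonalProjectionOnto x, Subtype.ext ?_⟩
    change F x = y
    have : y - F x = 0 := by
      refine hdisj _ ?_ (Rᗮ.sub_mem y.2 (hFR x))
      rw [← hx', add_sub_cancel_right]
      exact hTR x
    exact (sub_eq_zero.1 this).symm
  rcases le_total (Module.rank ℂ N) (Module.rank ℂ Rᗮ) with h | h
  · obtain ⟨j, hj⟩ := rank_le_iff_exists_linearMap.1 h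
    let e := LinearEquiv.ofBijective j ⟨hj, key j hj⟩
    exact ⟨e.finiteDimensional, e.finrank_eq.ge⟩
  · have : FiniteDimensional ℂ Rᗮ :=
      Module.rank_lt_aleph0_iff.1 (h.trans_lt (Module.rank_lt_aleph0 ℂ N))
    exact ⟨this, Module.finrank_le_finrank_of_rank_le_rank (by simpa using h)
      (Module.rank_lt_aleph0 ℂ N)⟩

end IndexZero

theorem uniformSpace_eq_comap_of_norm_eq {E F : Type*} [AddCommGroup E] [Module ℂ E]
    [NormedAddCommGroup F] [Module ℂ F] (p : Seminorm ℂ E) (f : E →ₗ[ℂ] F)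
    (h : ∀ x, ‖f x‖ = p x) :
    p.toSeminormedAddCommGroup.toUniformSpace = UniformSpace.comap f inferInstance := by
  let _ := p.toSeminormedAddCommGroup
  have : Isometry f := by
    refine Isometry.of_dist_eq fun x y => ?_
    rw [dist_eq_norm, dist_eq_norm, ← map_sub, h]
    rfl
  exact this.isUniformInducing.comap_uniformSpace.symm

namespace CStarCalculus

/-! ### Calculations with elements of order zero -/

section Elements

variable {ν : ℕ} (𝒜 : CStarCalculus.{u} ν)

theorem toCompleted₀_mul (a b : 𝒜.obj 0) :
    𝒜.toCompleted₀ (𝒜.mul (zero_add 0) a b) = 𝒜.toCompleted₀ a * 𝒜.toCompleted₀ b :=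
  Completion.coe_mul (α := 𝒜.Alg₀) a b

theorem toCompleted₀_one : 𝒜.toCompleted₀ 𝒜.one = 1 := rfl

theorem toCompleted₀_adj (h : star (0 : Fin ν → ℂ) = 0) (a : 𝒜.obj 0) :
    𝒜.toCompleted₀ (𝒜.adj h a) = star (𝒜.toCompleted₀ a) :=
  Completed₀.coe_star 𝒜 a

/-- The element `e a e'` of order zero, for `a` of order zero and `e`, `e'` of opposite orders. -/
def conj {k k' : Fin ν → ℂ} (h : k + k' = 0) (e : 𝒜.obj k) (a : 𝒜.obj 0) (e' : 𝒜.obj k') :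
    𝒜.obj 0 :=
  𝒜.mul h (𝒜.mul (add_zero k) e a) e'

theorem conj_conj {k k' l l' m m' : Fin ν → ℂ} (hk : k + k' = 0) (hl : l + l' = 0)
    (hm : l + k = m) (hm' : k' + l' = m') (h : m + m' = 0) (e : 𝒜.obj k) (e' : 𝒜.obj k')
    (f : 𝒜.obj l) (f' : 𝒜.obj l') (a : 𝒜.obj 0) :
    𝒜.conj h (𝒜.mul hm f e) a (𝒜.mul hm' e' f') = 𝒜.conj hl f (𝒜.conj hk e a e') f' := by
  subst hm hm'
  have h2 : l + k + k' = l := by rw [add_assoc, hk, add_zero]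
  have h3 : 0 + l' = l' := zero_add l'
  have h4 : k + (k' + l') = l' := by rw [← add_assoc, hk, zero_add]
  simp only [conj]
  rw [← 𝒜.mul_assoc h2 hl rfl h, 𝒜.mul_assoc rfl (add_zero (l + k)) (add_zero k) rfl f e a,
    𝒜.mul_assoc rfl h2 hk (add_zero l)]

theorem conj_one {k k' : Fin ν → ℂ} (h : k + k' = 0) (e : 𝒜.obj k) (e' : 𝒜.obj k') :
    𝒜.conj h e 𝒜.one e' = 𝒜.mul h e e' := by
  rw [conj, 𝒜.mul_one]

theorem adj_conj {k k' l l' : Fin ν → ℂ} (h : k + k' = 0) (hl : star k' = l) (hl' : star k = l')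
    (h' : l + l' = 0) (e : 𝒜.obj k) (a : 𝒜.obj 0) (e' : 𝒜.obj k') :
    𝒜.adj (star_zero _) (𝒜.conj h e a e') =
      𝒜.conj h' (𝒜.adj hl e') (𝒜.adj (star_zero _) a) (𝒜.adj hl' e) := by
  rw [conj, 𝒜.adj_mul h hl' hl (star_zero _) h', 𝒜.adj_mul (add_zero k) hl' (star_zero _) hl'
    (zero_add l'), conj, 𝒜.mul_assoc (add_zero l) h' (zero_add l') h']

end Elements

/-! ### Operators on `L²` and on distribution vectors, and a criterion for smoothness. -/

namespace Rep

variable {ν : ℕ} {𝒜 : CStarCalculus.{u} ν} (π : Rep.{u, w} 𝒜)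

theorem denseRange_smoothToL2 : DenseRange π.smoothToL2 :=
  Completion.denseRange_coe (α := π.V)

theorem smoothToL2_injective : Function.Injective π.smoothToL2 :=
  Completion.coe_injective π.V

theorem smoothAct_smoothAct {k l m : Fin ν → ℂ} (h : k + l = m) (a : 𝒜.obj k) (b : 𝒜.obj l)
    (x : π.Smooth) : π.smoothAct a (π.smoothAct b x) = π.smoothAct (𝒜.mul h a b) x :=
  (LinearMap.congr_fun (π.act_mul h a b) x).symm

theorem smoothAct_one (x : π.Smooth) : π.smoothAct 𝒜.one x = x :=
  LinearMap.congr_fun π.act_one x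

theorem distrAct_one (ξ : π.Distr) : π.distrAct 𝒜.one ξ = ξ := by
  ext η
  rw [distrAct_apply]
  have h : π.smoothAct (𝒜.adj rfl 𝒜.one) η = η := by
    have h0 : ∀ (m : Fin ν → ℂ) (hm : star (0 : Fin ν → ℂ) = m),
        π.smoothAct (𝒜.adj hm 𝒜.one) η = η := fun m hm => by
      obtain rfl : m = 0 := by rw [← hm, star_zero]
      rw [𝒜.adj_one, smoothAct_one]
    exact h0 _ rfl
  rw [h]

theorem distrAct_conj {k k' : Fin ν → ℂ} (h : k + k' = 0) (e : 𝒜.obj k) (a : 𝒜.obj 0)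
    (e' : 𝒜.obj k') (ξ : π.Distr) :
    π.distrAct (𝒜.conj h e a e') ξ = π.distrAct e (π.distrAct a (π.distrAct e' ξ)) := by
  rw [conj, ← distrAct_distrAct, ← distrAct_distrAct]

/-- The bounded operator on `L²(π)` given by an element of order at most zero. -/
noncomputable def bddAct {k : Fin ν → ℂ} (hk : ∀ i, (k i).re ≤ 0) (a : 𝒜.obj k) : π.L2 →L[ℂ] π.L2 :=
  ((π.act k a).mkContinuousOfExistsBound (π.bounded k hk a)).completion

theorem bddAct_smoothToL2 {k : Fin ν → ℂ} (hk : ∀ i, (k i).re ≤ 0) (a : 𝒜.obj k) (x : π.Smooth) :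
    π.bddAct hk a (π.smoothToL2 x) = π.smoothToL2 (π.smoothAct a x) := by
  let f := (π.act k a).mkContinuousOfExistsBound (π.bounded k hk a)
  have h (y : π.V) : f.completion (y : π.L2) = (f y : π.V) := by simp
  exact h x

theorem l2Rep_toCompleted₀ (a : 𝒜.obj 0) :
    π.l2Rep (𝒜.toCompleted₀ a) = π.bddAct (k := 0) (fun _ => le_rfl) a := by
  ext ξ
  refine congrFun (Continuous.ext_on π.denseRange_smoothToL2 (by fun_prop) (by fun_prop) ?_) ξ
  rintro _ ⟨x, rfl⟩
  rw [bddAct_smoothToL2]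
  exact π.l2Rep_coe a x

theorem distrAct_l2ToDistr {k : Fin ν → ℂ} (hk : ∀ i, (k i).re ≤ 0) (a : 𝒜.obj k) (ξ : π.L2) :
    π.distrAct a (π.l2ToDistr ξ) = π.l2ToDistr (π.bddAct hk a ξ) := by
  ext η
  rw [distrAct_apply, l2ToDistr_apply, l2ToDistr_apply]
  refine congrFun (Continuous.ext_on π.denseRange_smoothToL2
    (f := fun ξ => inner ℂ (π.smoothToL2 (π.smoothAct (𝒜.adj rfl a) η)) ξ)
    (g := fun ξ => inner ℂ (π.smoothToL2 η) (π.bddAct hk a ξ)) (by fun_prop) (by fun_prop) ?_) ξ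
  rintro _ ⟨x, rfl⟩
  have := DFunLike.congr_fun (π.distrAct_l2ToDistr_smooth a x) η
  simp only [bddAct_smoothToL2]
  exact this

theorem distrAct_l2ToDistr_zero (a : 𝒜.obj 0) (ξ : π.L2) :
    π.distrAct a (π.l2ToDistr ξ) = π.l2ToDistr (π.l2Rep (𝒜.toCompleted₀ a) ξ) := by
  rw [l2Rep_toCompleted₀, distrAct_l2ToDistr]

theorem l2Rep_injective_of_isUnit {b : 𝒜.Completed₀} (hb : IsUnit b) {ξ : π.L2}
    (h : π.l2Rep b ξ = 0) : ξ = 0 := by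
  obtain ⟨b, rfl⟩ := hb
  have : π.l2Rep (↑b⁻¹ * ↑b) ξ = 0 := by
    rw [map_mul]
    change π.l2Rep _ (π.l2Rep _ ξ) = 0
    rw [h, map_zero]
  rwa [Units.inv_mul, map_one] at this

/-- Apply `e'`: the product `e' e` acts invertibly on `L²`. The statement passes through
distribution vectors because `e` may have positive order and leave `L²`. -/
theorem eq_zero_of_distrAct_eq_zero {k k' : Fin ν → ℂ} (h : k' + k = 0) (e' : 𝒜.obj k')
    (e : 𝒜.obj k) (hu : IsUnit (𝒜.toCompleted₀ (𝒜.mul h e' e))) {ξ : π.L2}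
    (hξ : π.distrAct e (π.l2ToDistr ξ) = 0) : ξ = 0 := by
  refine π.l2Rep_injective_of_isUnit hu (π.l2ToDistr_injective ?_)
  rw [← distrAct_l2ToDistr_zero, ← distrAct_distrAct π h, hξ, map_zero, map_zero]

/-- If `π_0(a)` is injective on `L²(π)`, then so is `π_0(e a e')`. -/
theorem l2Rep_conj_injective {k k' : Fin ν → ℂ} (h : k + k' = 0) (h' : k' + k = 0)
    (hk' : ∀ i, (k' i).re ≤ 0) (e : 𝒜.obj k) (e' : 𝒜.obj k')
    (hu : IsUnit (𝒜.toCompleted₀ (𝒜.mul h e e'))) (hu' : IsUnit (𝒜.toCompleted₀ (𝒜.mul h' e' e)))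
    (a : 𝒜.obj 0) (ha : ∀ ξ, π.l2Rep (𝒜.toCompleted₀ a) ξ = 0 → ξ = 0) (ξ : π.L2)
    (hξ : π.l2Rep (𝒜.toCompleted₀ (𝒜.conj h e a e')) ξ = 0) : ξ = 0 := by
  have h1 : π.distrAct e (π.distrAct a (π.distrAct e' (π.l2ToDistr ξ))) = 0 := by
    rw [← distrAct_conj π h, distrAct_l2ToDistr_zero, hξ, map_zero]
  rw [distrAct_l2ToDistr π hk', distrAct_l2ToDistr_zero] at h1
  have h2 := ha _ (π.eq_zero_of_distrAct_eq_zero h' e' e hu' h1)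
  refine π.eq_zero_of_distrAct_eq_zero h e e' hu ?_
  rw [distrAct_l2ToDistr π hk', h2, map_zero]

/-- Turns completeness of the smooth vectors into closedness of their image in a product of copies
of `L²`. -/
theorem isUniformInducing_smoothAct : IsUniformInducing
    (fun (x : π.Smooth) (b : (k : Fin ν → ℂ) × 𝒜.obj k) => π.smoothToL2 (π.smoothAct b.2 x)) := by
  rw [isUniformInducing_iff_uniformSpace]
  rw [Pi.uniformSpace_eq, UniformSpace.comap_iInf]
  change _ = ⨅ b, (π.smoothSeminorm b).toSeminormedAddCommGroup.toUniformSpace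
  congr 1
  funext b
  rw [← UniformSpace.comap_comap]
  exact (uniformSpace_eq_comap_of_norm_eq (π.smoothSeminorm b)
    (π.smoothToL2 ∘ₗ (π.smoothAct b.2).toLinearMap)
    fun x => Completion.norm_coe (E := π.V) _).symm

/-- A vector in `L²(π)` that lies in the image of elements of arbitrarily negative order is
smooth. -/
theorem exists_smooth_of_forall {ξ : π.L2} (h : ∀ k : Fin ν → ℝ, (∀ i, 0 ≤ k i) →
      ∃ (e : 𝒜.obj (-(fun i => (k i : ℂ)))) (ζ : π.L2),
        π.l2ToDistr ξ = π.distrAct e (π.l2ToDistr ζ)) :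
    ∃ x : π.Smooth, π.smoothToL2 x = ξ := by
  have approx : ∀ I : Finset ((k : Fin ν → ℂ) × 𝒜.obj k), ∃ x : ℕ → π.Smooth, ∀ b ∈ I,
      ∃ ζ, π.distrAct b.2 (π.l2ToDistr ξ) = π.l2ToDistr ζ ∧
        Tendsto (fun n => π.smoothToL2 (π.smoothAct b.2 (x n))) atTop (𝓝 ζ) := by
    intro I
    -- This order dominates all orders occurring in `I`, so every product `b e` has order at most
    -- zero and acts boundedly.
    let k : Fin ν → ℝ := fun i => ∑ b ∈ I, |(b.1 i).re|
    obtain ⟨e, ζ, hζ⟩ := h k fun i => Finset.sum_nonneg fun b _ => abs_nonneg _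
    obtain ⟨y, hy⟩ : ∃ y : ℕ → π.Smooth, Tendsto (fun n => π.smoothToL2 (y n)) atTop (𝓝 ζ) := by
      obtain ⟨z, hz, hlim⟩ := mem_closure_iff_seq_limit.1 (π.denseRange_smoothToL2 ζ)
      choose y hy using hz
      exact ⟨y, by simpa only [hy] using hlim⟩
    refine ⟨fun n => π.smoothAct e (y n), fun b hb => ?_⟩
    have hre : ∀ i, ((b.1 + -(fun i => (k i : ℂ))) i).re ≤ 0 := fun i => by
      have h1 : |(b.1 i).re| ≤ k i :=
        Finset.single_le_sum (f := fun b => |(b.1 i).re|) (fun b _ => abs_nonneg _) hb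
      have h2 := le_abs_self (b.1 i).re
      simp
      linarith
    refine ⟨π.bddAct hre (𝒜.mul rfl b.2 e) ζ, ?_, ?_⟩
    · rw [hζ, distrAct_distrAct π rfl, distrAct_l2ToDistr]
    · simp_rw [smoothAct_smoothAct π rfl, ← bddAct_smoothToL2 π hre]
      exact ((π.bddAct hre _).continuous.tendsto ζ).comp hy
  have hp : ∀ b : (k : Fin ν → ℂ) × 𝒜.obj k, ∃ ζ,
      π.distrAct b.2 (π.l2ToDistr ξ) = π.l2ToDistr ζ := fun b => by
    obtain ⟨x, hx⟩ := approx {b}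
    obtain ⟨ζ, h1, -⟩ := hx b (by simp)
    exact ⟨ζ, h1⟩
  choose p hp using hp
  have hcl : IsClosed (Set.range fun (x : π.Smooth) (b : (k : Fin ν → ℂ) × 𝒜.obj k) =>
      π.smoothToL2 (π.smoothAct b.2 x)) :=
    (π.isUniformInducing_smoothAct.isComplete_range).isClosed
  have hmem : p ∈ closure (Set.range fun (x : π.Smooth) (b : (k : Fin ν → ℂ) × 𝒜.obj k) =>
      π.smoothToL2 (π.smoothAct b.2 x)) := by
    rw [mem_closure_iff_nhds]
    intro U hU
    rw [nhds_pi, Filter.mem_pi'] at hU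
    obtain ⟨I, t, ht, hsub⟩ := hU
    obtain ⟨x, hx⟩ := approx I
    have : ∀ᶠ n in atTop, ∀ b ∈ I, π.smoothToL2 (π.smoothAct b.2 (x n)) ∈ t b := by
      rw [Finset.eventually_all]
      intro b hb
      obtain ⟨ζ, h1, h2⟩ := hx b hb
      have : p b = ζ := π.l2ToDistr_injective ((hp b).symm.trans h1)
      exact h2 (this ▸ ht b)
    obtain ⟨n, hn⟩ := this.exists
    exact ⟨_, hsub fun b hb => hn b hb, ⟨x n, rfl⟩⟩
  rw [hcl.closure_eq] at hmem
  obtain ⟨x, hx⟩ := hmem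
  refine ⟨x, π.l2ToDistr_injective ?_⟩
  have h1 := congrFun hx ⟨0, 𝒜.one⟩
  have h2 := hp ⟨0, 𝒜.one⟩
  rw [distrAct_one] at h2
  rw [h2, ← h1]
  simp only [smoothAct_one]

end Rep

end CStarCalculus

/-! ### The ideal of elements acting by compact operators -/

section CompactIdeal

variable {B : Type u} [CStarAlgebra B] {H : Type v} [NormedAddCommGroup H] [InnerProductSpace ℂ H]
  [CompleteSpace H] (ρ : B →⋆ₐ[ℂ] (H →L[ℂ] H))

/-- The elements that act, together with their adjoints, by compact operators. -/
def compactIdeal : Ideal B where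
  -- Asking for compactness on both sides makes closure under the involution immediate.
  carrier := {x | IsCompactOperator (ρ x) ∧ IsCompactOperator (ρ (star x))}
  add_mem' := by
    rintro x y ⟨hx, hx'⟩ ⟨hy, hy'⟩
    refine ⟨?_, ?_⟩
    · rw [map_add]; exact hx.add hy
    · rw [star_add, map_add]; exact hx'.add hy'
  zero_mem' := by
    refine ⟨?_, ?_⟩
    · rw [map_zero]; exact isCompactOperator_zero
    · rw [star_zero, map_zero]; exact isCompactOperator_zero
  smul_mem' := by
    rintro b x ⟨hx, hx'⟩
    refine ⟨?_, ?_⟩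
    · rw [smul_eq_mul, map_mul]; exact hx.mul_left _
    · rw [smul_eq_mul, star_mul, map_mul]; exact hx'.mul_right _

theorem isStarIdeal_compactIdeal : IsStarIdeal (compactIdeal ρ) := by
  refine ⟨?_, ?_⟩
  · rintro x ⟨hx, hx'⟩ b
    refine ⟨?_, ?_⟩
    · rw [map_mul]; exact hx.mul_right _
    · rw [star_mul, map_mul]; exact hx'.mul_left _
  · rintro x ⟨hx, hx'⟩
    exact ⟨hx', by rwa [star_star]⟩

theorem InvertibleMod.exists_parametrix {x : B} (hx : InvertibleMod (compactIdeal ρ) x) :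
    ∃ T : H →L[ℂ] H, IsCompactOperator (T * ρ x - 1 : H →L[ℂ] H) ∧
      IsCompactOperator (ρ x * T - 1 : H →L[ℂ] H) := by
  obtain ⟨b, ⟨h1, -⟩, ⟨h2, -⟩⟩ := hx
  exact ⟨ρ b, by simpa using h1, by simpa using h2⟩

/-- Strictness comes from a non-zero self-adjoint rank-one operator: it lies in the image of `ρ`,
and its preimage cannot lie in `I`. -/
theorem lt_compactIdeal [Nontrivial H] {I : Ideal B} (hI : IsStarIdeal I) (hρ : ∀ y ∈ I, ρ y = 0)
    (hcpt : ∀ T : H →L[ℂ] H, IsCompactOperator T → ∃ b, ρ b = T) : I < compactIdeal ρ := by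
  refine lt_of_le_of_ne (fun y hy => ⟨?_, ?_⟩) fun heq => ?_
  · rw [hρ y hy]; exact isCompactOperator_zero
  · rw [hρ _ (hI.2 y hy)]; exact isCompactOperator_zero
  · obtain ⟨ξ, hξ⟩ := exists_ne (0 : H)
    let T : H →L[ℂ] H := InnerProductSpace.rankOne ℂ ξ ξ
    have hT : IsCompactOperator T :=
      (isCompactOperator_of_locallyCompactSpace_rng
        (ContinuousLinearMap.toSpanSingleton ℂ ξ)).comp_clm (innerSL ℂ ξ)
    have hTs : star T = T := by
      rw [ContinuousLinearMap.star_eq_adjoint, InnerProductSpace.adjoint_rankOne]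
    obtain ⟨b, hb⟩ := hcpt T hT
    have hmem : b ∈ compactIdeal ρ := ⟨by rwa [hb], by rwa [map_star, hb, hTs]⟩
    rw [← heq] at hmem
    have h0 : T ξ = 0 := by rw [← hb, hρ b hmem]; rfl
    have h1 : T ξ = (inner ℂ ξ ξ : ℂ) • ξ := rfl
    rw [h1, smul_eq_zero, inner_self_eq_zero] at h0
    exact hξ (h0.elim id id)

end CompactIdeal

/-! ### Detection of non-invertibility by the given set of representations. -/

namespace CStarCalculus

variable {ν : ℕ} {𝒜 : CStarCalculus.{u} ν}

/-- The set of representations detects invertibility modulo ideals, by representations whose image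
contains the compact operators. -/
def DetectsInvertibility (S : Set (Rep.{u, v} 𝒜)) : Prop :=
  ∀ (I : Ideal 𝒜.Completed₀), IsStarIdeal I → ∀ x, ¬ InvertibleMod I x →
    ∃ π ∈ S, (∀ y ∈ I, π.l2Rep y = 0) ∧
      (∃ ξ : π.L2, ξ ≠ 0 ∧ (π.l2Rep x ξ = 0 ∨ π.l2Rep (star x) ξ = 0)) ∧
      ∀ T : π.L2 →L[ℂ] π.L2, IsCompactOperator T → ∃ b, π.l2Rep b = T

theorem detectsInvertibility {S : Set (Rep.{u, v} 𝒜)} (hI : IsTypeI 𝒜.Completed₀)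
    (hS : ∀ (H : Type u) [NormedAddCommGroup H] [InnerProductSpace ℂ H] [CompleteSpace H]
      (ρ : 𝒜.Completed₀ →⋆ₐ[ℂ] (H →L[ℂ] H)), IsIrreducibleRep ρ →
        ∃ π ∈ S, UnitarilyEquivalent ρ π.l2Rep) : DetectsInvertibility S := by
  intro I hIs x hx
  obtain ⟨H, i1, i2, i3, ρ, hρ, hk, ξ, hξ, h⟩ := exists_irreducibleRep_of_not_invertibleMod hIs hx
  obtain ⟨π, hπ, U, hU⟩ := hS H ρ hρ
  have hU' : ∀ b (η : π.L2), π.l2Rep b η = U (ρ b (U.symm η)) := fun b η => by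
    rw [hU, LinearIsometryEquiv.apply_symm_apply]
  refine ⟨π, hπ, fun y hy => ?_, ⟨U ξ, by simpa using hξ, ?_⟩, fun T hT => ?_⟩
  · ext η
    rw [hU', hk y hy]
    simp
  · rw [← hU, ← hU]
    simpa using h
  · let V : H →L[ℂ] π.L2 := (U.toContinuousLinearEquiv : H →L[ℂ] π.L2)
    let V' : π.L2 →L[ℂ] H := (U.symm.toContinuousLinearEquiv : π.L2 →L[ℂ] H)
    obtain ⟨b, hb⟩ := hI H ρ hρ (V' ∘L T ∘L V) ((hT.comp_clm V).clm_comp V')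
    refine ⟨b, ?_⟩
    ext η
    rw [hU', hb]
    simp [V, V']

instance (π : Rep.{u, w} 𝒜) : Nontrivial π.L2 :=
  (Completion.coe_injective π.V).nontrivial

/-! ### Continuous families of elements -/

/-- A family `v_k` such that `v_0` is invertible and `k ↦ v_k a v_{-k}` is continuous. -/
structure IsContinuousFamily (v : ∀ k, 𝒜.obj k) : Prop where
  isUnit : IsUnit (𝒜.toCompleted₀ (v 0))
  continuousOn : ∀ a : 𝒜.obj 0, ContinuousOn (fun k : Fin ν → ℂ =>
    𝒜.toCompleted₀ (𝒜.conj (add_neg_cancel k) (v k) a (v (-k)))) (orderCross ν)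

/-- The orders `k` for which `v_m v_{-m}` is invertible for all `m` on the segment from `-k` to
`k`. -/
def invertibleOrders (v : ∀ k, 𝒜.obj k) : Set (Fin ν → ℂ) :=
  {k ∈ orderCross ν | ∀ t ∈ Set.Icc (0 : ℝ) 1, ∀ (m m' : Fin ν → ℂ) (h : m + m' = 0),
    m = t • k ∨ m' = t • k → IsUnit (𝒜.toCompleted₀ (𝒜.mul h (v m) (v m')))}

theorem smul_mem_orderCross {k : Fin ν → ℂ} (hk : k ∈ orderCross ν) {t : ℝ}
    (ht : t ∈ Set.Icc (0 : ℝ) 1) : t • k ∈ orderCross ν := by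
  have aux : ∀ x : ℝ, x ∈ Set.Icc (-1 : ℝ) 1 → t * x ∈ Set.Icc (-1 : ℝ) 1 := fun x hx => by
    obtain ⟨h1, h2⟩ := ht
    obtain ⟨h3, h4⟩ := hx
    constructor <;> nlinarith
  refine ⟨fun i j hi hj => hk.1 i j ?_ ?_, fun i => ⟨?_, ?_⟩⟩
  · rintro h; simp [h] at hi
  · rintro h; simp [h] at hj
  · simpa using aux _ (hk.2 i).1
  · simpa using aux _ (hk.2 i).2

theorem neg_mem_orderCross {k : Fin ν → ℂ} (hk : k ∈ orderCross ν) : -k ∈ orderCross ν := by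
  refine ⟨fun i j hi hj => hk.1 i j (by simpa using hi) (by simpa using hj), fun i => ?_⟩
  obtain ⟨⟨h1, h2⟩, h3, h4⟩ := hk.2 i
  simp only [Pi.neg_apply, Complex.neg_re, Complex.neg_im, Set.mem_Icc]
  refine ⟨⟨?_, ?_⟩, ?_, ?_⟩ <;> linarith

theorem star_mem_orderCross {k : Fin ν → ℂ} (hk : k ∈ orderCross ν) : star k ∈ orderCross ν := by
  refine ⟨fun i j hi hj => hk.1 i j (by simpa using hi) (by simpa using hj), fun i => ?_⟩
  obtain ⟨⟨h1, h2⟩, h3, h4⟩ := hk.2 i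
  simp only [Pi.star_apply, Complex.star_def, Complex.conj_re, Complex.conj_im, Set.mem_Icc]
  refine ⟨⟨?_, ?_⟩, ?_, ?_⟩ <;> linarith

theorem neg_mem_invertibleOrders {v : ∀ k, 𝒜.obj k} {k : Fin ν → ℂ}
    (hk : k ∈ invertibleOrders v) : -k ∈ invertibleOrders v := by
  refine ⟨neg_mem_orderCross hk.1, fun t ht m m' h hm => hk.2 t ht m m' h ?_⟩
  have h1 : m = -m' := eq_neg_of_add_eq_zero_left h
  rcases hm with rfl | rfl
  · right
    rw [smul_neg] at h1
    exact (neg_injective h1).symm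
  · left
    rw [h1, smul_neg, neg_neg]

theorem smul_mem_invertibleOrders {v : ∀ k, 𝒜.obj k} {k : Fin ν → ℂ}
    (hk : k ∈ invertibleOrders v) {s : ℝ} (hs : s ∈ Set.Icc (0 : ℝ) 1) :
    s • k ∈ invertibleOrders v := by
  refine ⟨smul_mem_orderCross hk.1 hs, fun t ht m m' h hm => hk.2 (t * s) ?_ m m' h ?_⟩
  · exact ⟨mul_nonneg ht.1 hs.1, mul_le_one₀ ht.2 hs.1 hs.2⟩
  · simpa only [mul_smul] using hm

/-- The family is dependent, so equal orders have to be substituted rather than rewritten. -/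
theorem conj_congr (v : ∀ k, 𝒜.obj k) {m m' n n' : Fin ν → ℂ} (hm : m = n) (hm' : m' = n')
    (h : m + m' = 0) (h' : n + n' = 0) (a : 𝒜.obj 0) :
    𝒜.conj h (v m) a (v m') = 𝒜.conj h' (v n) a (v n') := by
  subst hm hm'
  rfl

theorem adj_congr (v : ∀ k, 𝒜.obj k) {m n l : Fin ν → ℂ} (hm : m = n) (h : star m = l)
    (h' : star n = l) : 𝒜.adj h (v m) = 𝒜.adj h' (v n) := by
  subst hm
  rfl

theorem toCompleted₀_conj_zero (v : ∀ k, 𝒜.obj k) {m m' : Fin ν → ℂ} (hm : m = 0) (hm' : m' = 0)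
    (h : m + m' = 0) (a : 𝒜.obj 0) : 𝒜.toCompleted₀ (𝒜.conj h (v m) a (v m')) =
      𝒜.toCompleted₀ (v 0) * 𝒜.toCompleted₀ a * 𝒜.toCompleted₀ (v 0) := by
  subst hm hm'
  rw [conj, ← toCompleted₀_mul, ← toCompleted₀_mul]

/-- The elements `v_{tk} a v_{-tk}` in the completed algebra. -/
noncomputable def conjPath (v : ∀ k, 𝒜.obj k) (k : Fin ν → ℂ) (a : 𝒜.obj 0) (t : ℝ) :
    𝒜.Completed₀ :=
  𝒜.toCompleted₀ (𝒜.conj (add_neg_cancel (t • k)) (v (t • k)) a (v (-(t • k))))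

theorem conjPath_zero (v : ∀ k, 𝒜.obj k) (k : Fin ν → ℂ) (a : 𝒜.obj 0) : conjPath v k a 0 =
      𝒜.toCompleted₀ (v 0) * 𝒜.toCompleted₀ a * 𝒜.toCompleted₀ (v 0) :=
  toCompleted₀_conj_zero v (by simp) (by simp) _ a

theorem conjPath_one (v : ∀ k, 𝒜.obj k) (k : Fin ν → ℂ) (a : 𝒜.obj 0) : conjPath v k a 1 =
      𝒜.toCompleted₀ (𝒜.conj (add_neg_cancel k) (v k) a (v (-k))) :=
  congrArg _ (conj_congr v (one_smul _ _) (by rw [one_smul]) _ _ a)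

/-! ### Conjugation by the family preserves invertibility modulo ideals. -/

namespace IsContinuousFamily

variable {v : ∀ k, 𝒜.obj k}

theorem continuousOn_conjPath (hv : IsContinuousFamily v) {k : Fin ν → ℂ} (hk : k ∈ orderCross ν)
    (a : 𝒜.obj 0) : ContinuousOn (conjPath v k a) (Set.Icc 0 1) :=
  (hv.continuousOn a).comp (f := fun t : ℝ => t • k)
    (by fun_prop : Continuous fun t : ℝ => t • k).continuousOn
    fun _ ht => smul_mem_orderCross hk ht

/-- If `π_0(a)` is of index zero, then so is `π_0(v_k a v_{-k})`, provided that the path from `a` to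
`v_k a v_{-k}` consists of Fredholm operators. -/
theorem isIndexZero_conjPath (hv : IsContinuousFamily v) {k : Fin ν → ℂ} (hk : k ∈ orderCross ν)
    (a : 𝒜.obj 0) (π : Rep.{u, w} 𝒜)
    (hinv : ∀ t ∈ Set.Icc (0 : ℝ) 1, InvertibleMod (compactIdeal π.l2Rep) (conjPath v k a t))
    (ha : IsIndexZero (π.l2Rep (𝒜.toCompleted₀ a))) {t : ℝ} (ht : t ∈ Set.Icc (0 : ℝ) 1) :
    IsIndexZero (π.l2Rep (conjPath v k a t)) := by
  refine IsIndexZero.of_path (F := fun t => π.l2Rep (conjPath v k a t))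
    (π.continuous_l2RingHom.comp_continuousOn (hv.continuousOn_conjPath hk a))
    (fun t ht => (hinv t ht).exists_parametrix) ?_ ht
  -- The path starts at `v_0 a v_0` with `v_0` invertible, a product of operators of index zero.
  rw [conjPath_zero, map_mul, map_mul]
  have h0 := (hv.isUnit.map π.l2Rep).isIndexZero
  exact (h0.mul ha).mul h0

variable {S : Set (Rep.{u, v} 𝒜)}

/-- A failure would give a representation in which the whole path is Fredholm, starts at an
invertible operator and stays injective, so that no kernel can occur. The sign of `Re k` ensures
that `v_{-tk}` acts on `L²`. -/
theorem invertibleMod_conj_of_nonneg (hS : DetectsInvertibility S) (hv : IsContinuousFamily v)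
    {k : Fin ν → ℂ} (hk : k ∈ invertibleOrders v) (hre : ∀ i, 0 ≤ (k i).re)
    {J : Ideal 𝒜.Completed₀} (hJ : IsStarIdeal J) {a : 𝒜.obj 0}
    (ha : InvertibleMod J (𝒜.toCompleted₀ a)) :
    InvertibleMod J (𝒜.toCompleted₀ (𝒜.conj (add_neg_cancel k) (v k) a (v (-k)))) := by
  rw [← conjPath_one]
  by_contra hnot
  -- Maximality is required for the entire path and not only for its endpoint, since index zero is
  -- carried from `t = 0` through Fredholm operators.
  obtain ⟨I, hI, hJI, ⟨t, ht, hIt⟩, hmax⟩ := exists_maximal_starIdeal isCompact_Icc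
    (hv.continuousOn_conjPath hk.1 a) hJ ⟨1, by simp, hnot⟩
  obtain ⟨π, -, hπI, ⟨ξ, hξ, hker⟩, hcpt⟩ := hS I hI _ hIt
  have hinv := hmax _ (isStarIdeal_compactIdeal π.l2Rep) (lt_compactIdeal π.l2Rep hI hπI hcpt)
  -- Inverses modulo `J` become true inverses here, because `I` contains `J` and acts by zero.
  have hunit : IsUnit (π.l2Rep (𝒜.toCompleted₀ a)) := by
    obtain ⟨b, h1, h2⟩ := ha.mono hJI
    have h1' := hπI _ h1
    have h2' := hπI _ h2
    rw [map_sub, map_mul, map_one, sub_eq_zero] at h1' h2'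
    exact ⟨⟨_, _, h2', h1'⟩, rfl⟩
  have hidx := hv.isIndexZero_conjPath hk.1 a π hinv hunit.isIndexZero ht
  have hu := hidx.isUnit fun η hη => by
    refine π.l2Rep_conj_injective (add_neg_cancel (t • k)) (neg_add_cancel (t • k)) (fun i => ?_)
      (v (t • k)) (v (-(t • k))) (hk.2 t ht _ _ _ (.inl rfl)) (hk.2 t ht _ _ _ (.inr rfl)) a
      (fun ζ hζ => ?_) η hη
    · have := mul_nonneg ht.1 (hre i)
      simpa using this
    · exact (map_eq_zero_iff _ (ContinuousLinearMap.isUnit_iff_bijective.1 hunit).1).1 hζ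
  rcases hker with h | h
  · exact hξ ((map_eq_zero_iff _ (ContinuousLinearMap.isUnit_iff_bijective.1 hu).1).1 h)
  · have hu' := hu.star
    rw [← map_star] at hu'
    exact hξ ((map_eq_zero_iff _ (ContinuousLinearMap.isUnit_iff_bijective.1 hu').1).1 h)

/-- The family of adjoints `k ↦ (v_{k̄})*`. -/
def adjFamily (v : ∀ k, 𝒜.obj k) (k : Fin ν → ℂ) : 𝒜.obj k := 𝒜.adj (star_star k) (v (star k))

theorem adj_conj_adjFamily (v : ∀ k, 𝒜.obj k) {m m' n n' : Fin ν → ℂ} (h : m + m' = 0)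
    (h' : n + n' = 0) (hn : star m' = n) (hn' : star m = n') (a : 𝒜.obj 0) :
    𝒜.conj h' (adjFamily v n) a (adjFamily v n') =
      𝒜.adj (star_zero _) (𝒜.conj h (v m) (𝒜.adj (star_zero _) a) (v m')) := by
  rw [adj_conj 𝒜 h hn hn' h', 𝒜.adj_adj]
  subst hn hn'
  rw [adjFamily, adjFamily, adj_congr v (star_star m') _ rfl, adj_congr v (star_star m) _ rfl]

theorem adjFamily_isContinuousFamily (hv : IsContinuousFamily v) :
    IsContinuousFamily (adjFamily v) := by
  constructor
  · have : adjFamily v 0 = 𝒜.adj (star_zero _) (v 0) := adj_congr v (star_zero _) _ _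
    rw [this, toCompleted₀_adj]
    exact hv.isUnit.star
  · intro a
    have h1 := (hv.continuousOn (𝒜.adj (star_zero _) a)).comp (s := orderCross ν)
      (f := fun k : Fin ν → ℂ => -star k) (by fun_prop : Continuous fun k : Fin ν → ℂ =>
        -star k).continuousOn (fun k hk => neg_mem_orderCross (star_mem_orderCross hk))
    refine ((Completed₀.continuous_star 𝒜).comp_continuousOn h1).congr fun k hk => ?_
    rw [Function.comp_apply, Function.comp_apply, ← toCompleted₀_adj 𝒜 (star_zero _)]
    exact congrArg _ (adj_conj_adjFamily v _ _ (by simp) (by simp) a)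

theorem invertibleOrders_adjFamily {k : Fin ν → ℂ} (hk : k ∈ invertibleOrders v) :
    star k ∈ invertibleOrders (adjFamily v) := by
  refine ⟨star_mem_orderCross hk.1, fun t ht m m' h hm => ?_⟩
  have h' : star m' + star m = 0 := by rw [add_comm, ← star_add, h, star_zero]
  have := adj_conj_adjFamily v h' h (star_star m) (star_star m') 𝒜.one
  rw [𝒜.adj_one, conj_one, conj_one] at this
  rw [this, toCompleted₀_adj]
  refine (hk.2 t ht _ _ h' ?_).star
  rcases hm with rfl | rfl
  · right
    ext i; simp
  · left
    ext i; simp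

theorem invertibleMod_conj (hS : DetectsInvertibility S) (hv : IsContinuousFamily v)
    {k : Fin ν → ℂ} (hk : k ∈ invertibleOrders v)
    {J : Ideal 𝒜.Completed₀} (hJ : IsStarIdeal J) {a : 𝒜.obj 0}
    (ha : InvertibleMod J (𝒜.toCompleted₀ a)) :
    InvertibleMod J (𝒜.toCompleted₀ (𝒜.conj (add_neg_cancel k) (v k) a (v (-k)))) := by
  -- At most one coordinate is non-zero, so the real part has a definite sign. The negative case
  -- passes to adjoints, which replaces `k` by `-k̄`.
  have hsign : (∀ i, 0 ≤ (k i).re) ∨ ∀ i, (k i).re ≤ 0 := by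
    by_contra! hcon
    obtain ⟨⟨i, hi⟩, j, hj⟩ := hcon
    have hij : i = j := hk.1.1 i j (fun h => by simp [h] at hi) (fun h => by simp [h] at hj)
    subst hij
    exact lt_asymm hi hj
  rcases hsign with hre | hre
  · exact invertibleMod_conj_of_nonneg hS hv hk hre hJ ha
  · rw [← invertibleMod_star_iff hJ, ← toCompleted₀_adj 𝒜 (star_zero _)]
    have h1 := invertibleMod_conj_of_nonneg hS (adjFamily_isContinuousFamily hv)
      (k := -star k) (neg_mem_invertibleOrders (invertibleOrders_adjFamily hk))
      (fun i => by simpa using hre i) hJ (a := 𝒜.adj (star_zero _) a)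
      (by rw [toCompleted₀_adj]; exact ha.star hJ)
    rw [adj_conj_adjFamily v (add_neg_cancel k) _ (by simp) (by simp), 𝒜.adj_adj] at h1
    exact h1

end IsContinuousFamily

end CStarCalculus

namespace CStarCalculus

variable {ν : ℕ} {𝒜 : CStarCalculus.{u} ν}

/-! ### Transport of invertibility between Sobolev orders -/

/-- Conjugation by `e`, `e'` preserves invertibility modulo ideals and, for Fredholm operators,
index zero. -/
structure IsTransport {k k' : Fin ν → ℂ} (h : k + k' = 0) (e : 𝒜.obj k) (e' : 𝒜.obj k') :
    Prop where
  invertibleMod : ∀ J : Ideal 𝒜.Completed₀, IsStarIdeal J → ∀ a : 𝒜.obj 0,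
    InvertibleMod J (𝒜.toCompleted₀ a) → InvertibleMod J (𝒜.toCompleted₀ (𝒜.conj h e a e'))
  isIndexZero : ∀ (π : Rep.{u, v} 𝒜) (a : 𝒜.obj 0),
    InvertibleMod (compactIdeal π.l2Rep) (𝒜.toCompleted₀ a) →
    IsIndexZero (π.l2Rep (𝒜.toCompleted₀ a)) →
    IsIndexZero (π.l2Rep (𝒜.toCompleted₀ (𝒜.conj h e a e')))

/-- There are elements of orders `k` and `-k` that transport invertibility in both directions. -/
def HasTransport (𝒜 : CStarCalculus.{u} ν) (k : Fin ν → ℂ) : Prop :=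
  ∃ (e : 𝒜.obj k) (e' : 𝒜.obj (-k)), IsTransport.{u, v} (add_neg_cancel k) e e' ∧
    IsTransport.{u, v} (neg_add_cancel k) e' e

theorem IsTransport.isUnit_conj {k k' : Fin ν → ℂ} {h : k + k' = 0} {e : 𝒜.obj k} {e' : 𝒜.obj k'}
    (he : IsTransport.{u, v} h e e') {a : 𝒜.obj 0} (ha : IsUnit (𝒜.toCompleted₀ a)) :
    IsUnit (𝒜.toCompleted₀ (𝒜.conj h e a e')) :=
  invertibleMod_bot.1 (he.invertibleMod ⊥ isStarIdeal_bot a (invertibleMod_bot.2 ha))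

theorem IsTransport.isUnit_mul {k k' : Fin ν → ℂ} {h : k + k' = 0} {e : 𝒜.obj k} {e' : 𝒜.obj k'}
    (he : IsTransport.{u, v} h e e') : IsUnit (𝒜.toCompleted₀ (𝒜.mul h e e')) := by
  rw [← conj_one]
  exact he.isUnit_conj isUnit_one

/-- Conjugations compose. The clause on ideals is what keeps the inner conjugate Fredholm, as the
index clause of the outer one requires. -/
theorem IsTransport.mul {k k' l l' m m' : Fin ν → ℂ} {hk : k + k' = 0} {hl : l + l' = 0}
    {e : 𝒜.obj k} {e' : 𝒜.obj k'} {f : 𝒜.obj l} {f' : 𝒜.obj l'}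
    (he : IsTransport.{u, v} hk e e') (hf : IsTransport.{u, v} hl f f') (hm : l + k = m)
    (hm' : k' + l' = m') (h : m + m' = 0) :
    IsTransport.{u, v} h (𝒜.mul hm f e) (𝒜.mul hm' e' f') := by
  constructor
  · intro J hJ a ha
    rw [conj_conj 𝒜 hk hl hm hm' h]
    exact hf.invertibleMod J hJ _ (he.invertibleMod J hJ a ha)
  · intro π a ha hi
    rw [conj_conj 𝒜 hk hl hm hm' h]
    exact hf.isIndexZero π _ (he.invertibleMod _ (isStarIdeal_compactIdeal _) a ha)
      (he.isIndexZero π a ha hi)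

theorem HasTransport.add {k l : Fin ν → ℂ} (hk : HasTransport.{u, v} 𝒜 k)
    (hl : HasTransport.{u, v} 𝒜 l) : HasTransport.{u, v} 𝒜 (k + l) := by
  obtain ⟨e, e', h1, h2⟩ := hk
  obtain ⟨f, f', h3, h4⟩ := hl
  exact ⟨𝒜.mul rfl e f, 𝒜.mul (neg_add_rev k l).symm f' e', h3.mul h1 _ _ _, h2.mul h4 _ _ _⟩

theorem IsContinuousFamily.hasTransport {S : Set (Rep.{u, v} 𝒜)} (hS : DetectsInvertibility S)
    {v : ∀ k, 𝒜.obj k} (hv : IsContinuousFamily v) {k : Fin ν → ℂ} (hk : k ∈ invertibleOrders v) :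
    HasTransport.{u, v} 𝒜 k := by
  have key : ∀ {k : Fin ν → ℂ}, k ∈ invertibleOrders v →
      IsTransport.{u, v} (add_neg_cancel k) (v k) (v (-k)) := by
    intro k hk
    refine ⟨fun J hJ a ha => hv.invertibleMod_conj hS hk hJ ha, fun π a ha hi => ?_⟩
    rw [← conjPath_one]
    exact hv.isIndexZero_conjPath hk.1 a π (fun t ht => hv.invertibleMod_conj hS
      (smul_mem_invertibleOrders hk ht) (isStarIdeal_compactIdeal _) ha) hi (by simp)
  have key' : ∀ (m m' : Fin ν → ℂ) (h : m + m' = 0), m ∈ invertibleOrders v →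
      IsTransport.{u, v} h (v m) (v m') := by
    intro m m' h hm
    obtain rfl : m' = -m := eq_neg_of_add_eq_zero_right h
    exact key hm
  exact ⟨v k, v (-k), key' _ _ _ hk, key' _ _ _ (neg_mem_invertibleOrders hk)⟩

/-- At `m = 0` the product `v_m v_{-m}` is the unit `v_0²`. Units are open, and the cross and the
ball are stable under sign and shrinking. -/
theorem IsContinuousFamily.exists_ball_subset {v : ∀ k, 𝒜.obj k} (hv : IsContinuousFamily v) :
    ∃ δ > 0, ∀ k ∈ orderCross ν, ‖k‖ < δ → k ∈ invertibleOrders v := by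
  have h0 : (0 : Fin ν → ℂ) ∈ orderCross ν := ⟨by simp, by simp⟩
  have hu : IsUnit (𝒜.toCompleted₀ (𝒜.conj (add_neg_cancel 0) (v 0) 𝒜.one (v (-0)))) := by
    rw [toCompleted₀_conj_zero v rfl neg_zero, toCompleted₀_one, _root_.mul_one]
    exact hv.isUnit.mul hv.isUnit
  have h1 := (hv.continuousOn 𝒜.one 0 h0).preimage_mem_nhdsWithin (Units.isOpen.mem_nhds hu)
  obtain ⟨δ, hδ, h2⟩ := Metric.mem_nhdsWithin_iff.1 h1
  refine ⟨δ, hδ, fun k hk hkδ => ⟨hk, fun t ht m m' h hm => ?_⟩⟩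
  have htk : ‖t • k‖ < δ := by
    rw [norm_smul, Real.norm_eq_abs, abs_of_nonneg ht.1]
    exact (mul_le_of_le_one_left (norm_nonneg k) ht.2).trans_lt hkδ
  have hcr := smul_mem_orderCross hk ht
  have hmm : m ∈ orderCross ν ∧ ‖m‖ < δ := by
    rcases hm with rfl | rfl
    · exact ⟨hcr, htk⟩
    · obtain rfl : m = -(t • k) := eq_neg_of_add_eq_zero_left h
      exact ⟨neg_mem_orderCross hcr, by rwa [norm_neg]⟩
  have h3 : IsUnit (𝒜.toCompleted₀ (𝒜.conj (add_neg_cancel m) (v m) 𝒜.one (v (-m)))) :=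
    h2 ⟨by simpa using hmm.2, hmm.1⟩
  obtain rfl : m' = -m := eq_neg_of_add_eq_zero_right h
  rwa [conj_one] at h3

theorem HasTransport.nsmul {k : Fin ν → ℂ} (h0 : HasTransport.{u, v} 𝒜 0)
    (hk : HasTransport.{u, v} 𝒜 k) (n : ℕ) : HasTransport.{u, v} 𝒜 (n • k) := by
  induction n with
  | zero => rwa [zero_smul]
  | succ n ih => rw [succ_nsmul]; exact ih.add hk

theorem IsContinuousFamily.hasTransport_all {S : Set (Rep.{u, v} 𝒜)} (hS : DetectsInvertibility S)
    {v : ∀ k, 𝒜.obj k} (hv : IsContinuousFamily v) (k : Fin ν → ℂ) : HasTransport.{u, v} 𝒜 k := by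
  obtain ⟨δ, hδ, hball⟩ := hv.exists_ball_subset
  have h0 : HasTransport.{u, v} 𝒜 0 :=
    hv.hasTransport hS (hball 0 ⟨by simp, by simp⟩ (by simpa using hδ))
  have hsingle : ∀ i, HasTransport.{u, v} 𝒜 (Pi.single i (k i)) := fun i => by
    -- The bound `δ` puts `k i / N` among the invertible orders, and the bound `1` keeps it in the
    -- cross.
    obtain ⟨N, hN⟩ := exists_nat_gt (‖k i‖ / min δ 1)
    have hmin : 0 < min δ 1 := lt_min hδ one_pos
    have hN0 : 0 < (N : ℝ) := (div_nonneg (norm_nonneg _) hmin.le).trans_lt hN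
    have hNc : (N : ℂ) ≠ 0 := by exact_mod_cast hN0.ne'
    have hlt : ‖k i / N‖ < min δ 1 := by
      rw [norm_div, Complex.norm_natCast, div_lt_iff₀ hN0]
      rwa [div_lt_iff₀ hmin, mul_comm] at hN
    have h1 : Pi.single i (k i) = N • (Pi.single i (k i / N) : Fin ν → ℂ) := by
      rw [← Pi.single_smul, nsmul_eq_mul, mul_div_cancel₀ _ hNc]
    rw [h1]
    refine h0.nsmul (hv.hasTransport hS (hball _ ⟨fun j j' hj hj' => ?_, fun j => ?_⟩ ?_)) N
    · have e1 : j = i := by by_contra h; exact hj (by simp [h])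
      have e2 : j' = i := by by_contra h; exact hj' (by simp [h])
      rw [e1, e2]
    · have hb : ‖(Pi.single i (k i / N) : Fin ν → ℂ) j‖ ≤ 1 := by
        refine (norm_le_pi_norm _ j).trans ?_
        rw [Pi.norm_single]
        exact hlt.le.trans (min_le_right _ _)
      exact ⟨abs_le.1 ((Complex.abs_re_le_norm _).trans hb),
        abs_le.1 ((Complex.abs_im_le_norm _).trans hb)⟩
    · rw [Pi.norm_single]
      exact hlt.trans_le (min_le_left _ _)
  rw [← Finset.univ_sum_single k]
  exact Finset.sum_induction _ (HasTransport.{u, v} 𝒜) (fun _ _ h h' => h.add h') h0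
    fun i _ => hsingle i

/-! ### Elliptic regularity -/

/-- The spectrum is real, so `x` is a limit of the invertible elements `x - i/(n+1)`; a Fredholm
limit of operators of index zero has index zero. -/
theorem isIndexZero_of_isSelfAdjoint (π : Rep.{u, w} 𝒜) {x : 𝒜.Completed₀}
    (hx : IsSelfAdjoint x) (hinv : InvertibleMod (compactIdeal π.l2Rep) x) :
    IsIndexZero (π.l2Rep x) := by
  obtain ⟨T, h1, h2⟩ := hinv.exists_parametrix
  refine IsIndexZero.of_mem_closure ?_ h1 h2
  have hu : ∀ n : ℕ, IsUnit (x - algebraMap ℂ _ ((1 / ((n : ℝ) + 1) : ℝ) * Complex.I)) := fun n => by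
    rw [← IsUnit.neg_iff, neg_sub]
    by_contra hspec
    have := hx.mem_spectrum_eq_re (spectrum.mem_iff.2 hspec)
    have him := congrArg Complex.im this
    simp at him
    norm_cast at him
  have hlim : Tendsto (fun n : ℕ =>
      π.l2Rep (x - algebraMap ℂ _ ((1 / ((n : ℝ) + 1) : ℝ) * Complex.I))) atTop (𝓝 (π.l2Rep x)) := by
    have hc : Tendsto (fun n : ℕ => x - algebraMap ℂ 𝒜.Completed₀
        ((1 / ((n : ℝ) + 1) : ℝ) * Complex.I)) atTop (𝓝 (x - algebraMap ℂ _ (((0 : ℝ) : ℂ) *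
          Complex.I))) := by
      have hc : Continuous fun r : ℝ => x - algebraMap ℂ 𝒜.Completed₀ ((r : ℂ) * Complex.I) :=
        continuous_const.sub ((continuous_algebraMap ℂ _).comp (by fun_prop))
      exact (hc.tendsto 0).comp tendsto_one_div_add_atTop_nhds_zero_nat
    rw [Complex.ofReal_zero, zero_mul, map_zero, sub_zero] at hc
    exact (π.continuous_l2RingHom.tendsto x).comp hc
  exact mem_closure_of_tendsto hlim (.of_forall fun n => ((hu n).map π.l2Rep).isIndexZero)

/-- The kernel in `L²(π)` of a self-adjoint Fredholm operator `π_0(a)` lies in the range of elements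
of negative order. -/
theorem IsTransport.exists_eq_of_mem_ker {k k' : Fin ν → ℂ} {h : k + k' = 0} {h' : k' + k = 0}
    {e : 𝒜.obj k} {e' : 𝒜.obj k'} (he : IsTransport.{u, v} h e e')
    (he' : IsTransport.{u, v} h' e' e) (hk' : ∀ i, (k' i).re ≤ 0) (π : Rep.{u, v} 𝒜) {a : 𝒜.obj 0}
    (ha : IsSelfAdjoint (𝒜.toCompleted₀ a))
    (hinv : InvertibleMod (compactIdeal π.l2Rep) (𝒜.toCompleted₀ a)) {ξ : π.L2}
    (hξ : π.l2Rep (𝒜.toCompleted₀ a) ξ = 0) : ∃ ζ, π.bddAct hk' e' ζ = ξ := by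
  set A := π.l2Rep (𝒜.toCompleted₀ a)
  set T := π.l2Rep (𝒜.toCompleted₀ (𝒜.conj h e a e')) with hT
  have hTidx : IsIndexZero T := he.isIndexZero π a hinv (isIndexZero_of_isSelfAdjoint π ha hinv)
  have hfin := hTidx.finiteDimensional_ker
  obtain ⟨hfin', hle⟩ := hTidx.finrank_orthogonal_range_le
  set N := LinearMap.ker (A : π.L2 →ₗ[ℂ] π.L2)
  set M := LinearMap.ker (T : π.L2 →ₗ[ℂ] π.L2)
  set R := LinearMap.range (T : π.L2 →ₗ[ℂ] π.L2)
  have hβ : ∀ ζ ∈ M, π.bddAct hk' e' ζ ∈ N := fun ζ hζ => by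
    have h0 : T ζ = 0 := hζ
    refine π.eq_zero_of_distrAct_eq_zero h' e' e he'.isUnit_mul ?_
    change π.distrAct e (π.l2ToDistr (A (π.bddAct hk' e' ζ))) = 0
    rw [← π.distrAct_l2ToDistr_zero, ← π.distrAct_l2ToDistr, ← π.distrAct_conj h,
      π.distrAct_l2ToDistr_zero, ← hT, h0, map_zero]
  -- Surjectivity of this injection is the claim. It follows from `dim N ≤ dim Rᗮ ≤ dim M`, where
  -- the second inequality is index zero of `T`.
  let φ : M →ₗ[ℂ] N := (π.bddAct hk' e' : π.L2 →ₗ[ℂ] π.L2).restrict hβ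
  have hφ : Function.Injective φ := by
    rw [injective_iff_map_eq_zero]
    intro ζ hζ
    refine Subtype.ext (π.eq_zero_of_distrAct_eq_zero h e e' he.isUnit_mul ?_)
    have : π.bddAct hk' e' ζ = 0 := congrArg Subtype.val hζ
    rw [π.distrAct_l2ToDistr hk', this, map_zero]
  obtain ⟨c, hc⟩ := he'.isUnit_mul.star
  have hsk' : ∀ i, (star k' i).re ≤ 0 := fun i => by simpa using hk' i
  have hs : star k' + star k = 0 := by rw [← star_add, h', star_zero]
  have hs' : star k + star k' = 0 := by rw [← star_add, h, star_zero]
  -- A right inverse of `e*`, since `e* e'* = (e' e)*`. As the adjoint of `T` is given by `e'* a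
  -- e*`, it sends the kernel of `a` into the cokernel of `T`.
  let ψ₀ : π.L2 →L[ℂ] π.L2 := π.bddAct hsk' (𝒜.adj rfl e') * π.l2Rep (↑c⁻¹ : 𝒜.Completed₀)
  have hψ₀ : ∀ η, π.distrAct (𝒜.adj rfl e) (π.l2ToDistr (ψ₀ η)) = π.l2ToDistr η := fun η => by
    change π.distrAct (𝒜.adj rfl e) (π.l2ToDistr (π.bddAct hsk' (𝒜.adj rfl e') _)) = _
    rw [← π.distrAct_l2ToDistr, π.distrAct_distrAct hs', ← 𝒜.adj_mul h' rfl rfl (star_zero _),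
      π.distrAct_l2ToDistr_zero, toCompleted₀_adj, ← hc]
    change π.l2ToDistr ((π.l2Rep (c : 𝒜.Completed₀) * π.l2Rep (↑c⁻¹ : 𝒜.Completed₀)) η) = _
    rw [← map_mul, Units.mul_inv, map_one]
    rfl
  have hψR : ∀ η ∈ N, ψ₀ η ∈ Rᗮ := fun η hη => by
    have hη0 : A η = 0 := hη
    rw [Submodule.mem_orthogonal]
    rintro _ ⟨x, rfl⟩
    have h0 : π.l2Rep (star (𝒜.toCompleted₀ (𝒜.conj h e a e'))) (ψ₀ η) = 0 := by
      refine π.l2ToDistr_injective ?_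
      rw [← toCompleted₀_adj 𝒜 (star_zero _), ← π.distrAct_l2ToDistr_zero,
        adj_conj 𝒜 h rfl rfl hs, π.distrAct_conj hs, hψ₀, π.distrAct_l2ToDistr_zero,
        toCompleted₀_adj, ha.star_eq]
      change π.distrAct _ (π.l2ToDistr (A η)) = _
      rw [hη0, map_zero, map_zero]
    rw [map_star, ContinuousLinearMap.star_eq_adjoint, ← hT] at h0
    change inner ℂ (T x) (ψ₀ η) = 0
    rw [← ContinuousLinearMap.adjoint_inner_right, h0, inner_zero_right]
  let ψ : N →ₗ[ℂ] Rᗮ := (ψ₀ : π.L2 →ₗ[ℂ] π.L2).restrict hψR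
  have hψ : Function.Injective ψ := by
    rw [injective_iff_map_eq_zero]
    intro η hη
    have h0 : ψ₀ η = 0 := congrArg Subtype.val hη
    refine Subtype.ext (π.l2ToDistr_injective ?_)
    rw [← hψ₀, h0, map_zero, map_zero]
    simp
  have hfinN : FiniteDimensional ℂ N := FiniteDimensional.of_injective ψ hψ
  have hfr : Module.finrank ℂ M = Module.finrank ℂ N :=
    le_antisymm (LinearMap.finrank_le_finrank_of_injective hφ)
      ((LinearMap.finrank_le_finrank_of_injective hψ).trans hle)
  obtain ⟨ζ, hζ⟩ := (LinearMap.injective_iff_surjective_of_finrank_eq_finrank hfr).1 hφ ⟨ξ, hξ⟩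
  exact ⟨ζ, congrArg Subtype.val hζ⟩

/-- At a maximal ideal of failure `a` is Fredholm with a kernel vector. Lying in the range of
elements of arbitrarily negative order, this vector is smooth, against injectivity. -/
theorem isUnit_of_isSelfAdjoint {S : Set (Rep.{u, v} 𝒜)} (hS : DetectsInvertibility S)
    (htr : ∀ k, HasTransport.{u, v} 𝒜 k) {a : 𝒜.obj 0} (ha : IsSelfAdjoint (𝒜.toCompleted₀ a))
    (hinj : ∀ π ∈ S, ∀ x : π.Smooth, π.smoothAct a x = 0 → x = 0) :
    IsUnit (𝒜.toCompleted₀ a) := by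
  by_contra hnot
  rw [← invertibleMod_bot] at hnot
  obtain ⟨I, hI, -, ⟨-, -, hIt⟩, hmax⟩ := exists_maximal_starIdeal (X := Unit) isCompact_univ
    (f := fun _ => 𝒜.toCompleted₀ a) continuousOn_const isStarIdeal_bot ⟨(), trivial, hnot⟩
  obtain ⟨π, hπ, hπI, ⟨ξ, hξ, hker⟩, hcpt⟩ := hS I hI _ hIt
  rw [ha.star_eq, or_self] at hker
  have hinv := hmax _ (isStarIdeal_compactIdeal π.l2Rep) (lt_compactIdeal π.l2Rep hI hπI hcpt)
    () trivial
  obtain ⟨x, hx⟩ := π.exists_smooth_of_forall (ξ := ξ) fun k hk => by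
    obtain ⟨e, e', h1, h2⟩ := htr fun i => (k i : ℂ)
    obtain ⟨ζ, hζ⟩ := h1.exists_eq_of_mem_ker h2 (fun i => by simpa using hk i) π ha hinv hker
    exact ⟨e', ζ, by rw [← hζ, π.distrAct_l2ToDistr]⟩
  have hax : π.smoothAct a x = 0 := by
    refine π.smoothToL2_injective ?_
    rw [← π.bddAct_smoothToL2 (fun _ => le_rfl), hx, ← π.l2Rep_toCompleted₀, hker, map_zero]
  rw [hinj π hπ x hax, map_zero] at hx
  exact hξ hx.symm

/-- Pair with `x`: `⟨x, a* a x⟩ = ‖a x‖²`. -/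
theorem smoothAct_eq_zero_of_adj_mul (π : Rep.{u, w} 𝒜) {k l : Fin ν → ℂ} (hl : star k = l)
    {m : Fin ν → ℂ} (hm : l + k = m)
    (a : 𝒜.obj k) {x : π.Smooth} (h : π.smoothAct (𝒜.mul hm (𝒜.adj hl a) a) x = 0) :
    π.smoothAct a x = 0 := by
  have h1 := π.inner_act hl a x (π.act k a x)
  have h2 : π.act l (𝒜.adj hl a) (π.act k a x) = 0 :=
    (π.smoothAct_smoothAct hm (𝒜.adj hl a) a x).trans h
  rw [h2] at h1
  exact (inner_self_eq_zero (E := π.V)).1 (h1.trans (inner_zero_right _))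

/-- Left invertibility is equivalent to injectivity on smooth vectors. -/
theorem exists_left_inverse_iff {S : Set (Rep.{u, v} 𝒜)} (hS : DetectsInvertibility S)
    (htr : ∀ k, HasTransport.{u, v} 𝒜 k) (a : 𝒜.obj 0) :
    (∃ b : 𝒜.Completed₀, b * 𝒜.toCompleted₀ a = 1) ↔
      ∀ π ∈ S, Function.Injective (π.smoothAct a) := by
  constructor
  · rintro ⟨b, hb⟩ π -
    rw [injective_iff_map_eq_zero]
    intro x hx
    refine π.smoothToL2_injective ?_
    have h1 : π.l2Rep (𝒜.toCompleted₀ a) (π.smoothToL2 x) = 0 := by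
      rw [π.l2Rep_toCompleted₀, π.bddAct_smoothToL2, hx, map_zero]
    have h2 : π.l2Rep (b * 𝒜.toCompleted₀ a) (π.smoothToL2 x) = 0 := by
      rw [map_mul]
      change π.l2Rep b (π.l2Rep _ _) = 0
      rw [h1, map_zero]
    rw [hb, map_one] at h2
    rw [map_zero]
    exact h2
  · intro h
    have hc : 𝒜.toCompleted₀ (𝒜.mul (zero_add 0) (𝒜.adj (star_zero _) a) a) =
        star (𝒜.toCompleted₀ a) * 𝒜.toCompleted₀ a := by
      rw [toCompleted₀_mul, toCompleted₀_adj]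
    have hu := isUnit_of_isSelfAdjoint hS htr
      (a := 𝒜.mul (zero_add 0) (𝒜.adj (star_zero _) a) a) (by
        rw [hc]; exact IsSelfAdjoint.star_mul_self _) fun π hπ x hx =>
        (injective_iff_map_eq_zero _).1 (h π hπ) x
          (smoothAct_eq_zero_of_adj_mul π (star_zero _) (zero_add 0) a hx)
    obtain ⟨c, hc'⟩ := hu
    rw [hc] at hc'
    exact ⟨↑c⁻¹ * star (𝒜.toCompleted₀ a), by rw [_root_.mul_assoc, ← hc', Units.inv_mul]⟩

end CStarCalculus

/-- The estimates say directly that the inverse is continuous. The seminorm families may be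
uncountable, so no open mapping argument is used. -/
theorem isHomeomorph_of_seminorm_le {E F ι : Type*} [AddCommGroup E] [Module ℂ E]
    [TopologicalSpace E] [AddCommGroup F] [Module ℂ F] [TopologicalSpace F]
    [IsTopologicalAddGroup F] {p : SeminormFamily ℂ E ι} (hp : WithSeminorms p) (f : E →ₗ[ℂ] F)
    (hf : Continuous f) (hbij : Function.Bijective f)
    (h : ∀ i, ∃ q : Seminorm ℂ F, Continuous q ∧ ∀ x, p i x ≤ q (f x)) : IsHomeomorph f := by
  let e := LinearEquiv.ofBijective f hbij
  refine isHomeomorph_iff_exists_inverse.2 ⟨hf, e.symm, e.left_inv, e.right_inv, ?_⟩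
  refine hp.continuous_of_continuous_comp e.symm.toLinearMap fun i => ?_
  obtain ⟨q, hq, hle⟩ := h i
  refine Seminorm.continuous_of_le hq fun y => ?_
  have := hle (e.symm y)
  rwa [show f (e.symm y) = y from e.apply_symm_apply y] at this

namespace CStarCalculus

variable {ν : ℕ} {𝒜 : CStarCalculus.{u} ν}

/-! ### Pairs of elements that are inverse up to invertible elements of order zero -/

/-- The products `g g'` and `g' g` are of order zero and invertible. -/
structure IsInversePair {k k' : Fin ν → ℂ} (g : 𝒜.obj k) (g' : 𝒜.obj k') : Prop where
  add_eq : k + k' = 0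
  add_eq' : k' + k = 0
  isUnit : IsUnit (𝒜.toCompleted₀ (𝒜.mul add_eq g g'))
  isUnit' : IsUnit (𝒜.toCompleted₀ (𝒜.mul add_eq' g' g))

theorem IsInversePair.symm {k k' : Fin ν → ℂ} {g : 𝒜.obj k} {g' : 𝒜.obj k'}
    (h : IsInversePair g g') : IsInversePair g' g :=
  ⟨h.add_eq', h.add_eq, h.isUnit', h.isUnit⟩

theorem IsInversePair.adj {k k' l l' : Fin ν → ℂ} {g : 𝒜.obj k} {g' : 𝒜.obj k'}
    (h : IsInversePair g g') (hl : star k = l) (hl' : star k' = l') :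
    IsInversePair (𝒜.adj hl g) (𝒜.adj hl' g') := by
  have h1 : l + l' = 0 := by rw [← hl, ← hl', ← star_add, h.add_eq, star_zero]
  have h2 : l' + l = 0 := by rw [add_comm, h1]
  refine ⟨h1, h2, ?_, ?_⟩
  · rw [← 𝒜.adj_mul h.add_eq' hl' hl (star_zero _) h1, toCompleted₀_adj]
    exact h.isUnit'.star
  · rw [← 𝒜.adj_mul h.add_eq hl hl' (star_zero _) h2, toCompleted₀_adj]
    exact h.isUnit.star

theorem IsTransport.isInversePair {k k' : Fin ν → ℂ} {h : k + k' = 0} {h' : k' + k = 0}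
    {e : 𝒜.obj k} {e' : 𝒜.obj k'} (he : IsTransport.{u, v} h e e')
    (he' : IsTransport.{u, v} h' e' e) : IsInversePair e e' :=
  ⟨h, h', he.isUnit_mul, he'.isUnit_mul⟩

/-- There are elements of every order `k` that are invertible up to order zero, such that
conjugation preserves invertibility. -/
def HasInversePairs (𝒜 : CStarCalculus.{u} ν) : Prop :=
  ∀ k : Fin ν → ℂ, ∃ (e : 𝒜.obj k) (e' : 𝒜.obj (-k)), IsInversePair e e' ∧
    ∀ a : 𝒜.obj 0, IsUnit (𝒜.toCompleted₀ a) →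
      IsUnit (𝒜.toCompleted₀ (𝒜.conj (add_neg_cancel k) e a e'))

/-- Dropping the index clause leaves a statement about the calculus alone, which applies to
representations in any universe. -/
theorem hasInversePairs (htr : ∀ k, HasTransport.{u, v} 𝒜 k) : HasInversePairs 𝒜 := fun k => by
  obtain ⟨e, e', h1, h2⟩ := htr k
  exact ⟨e, e', h1.isInversePair h2, fun a ha => h1.isUnit_conj ha⟩

namespace Rep

variable {π : Rep.{u, w} 𝒜}

theorem smoothAct_eq_zero {k k' : Fin ν → ℂ} {g : 𝒜.obj k} {g' : 𝒜.obj k'}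
    (h : IsInversePair g g') {x : π.Smooth} (hx : π.smoothAct g x = 0) : x = 0 := by
  refine π.smoothToL2_injective ?_
  rw [map_zero]
  refine π.eq_zero_of_distrAct_eq_zero h.add_eq' g' g h.isUnit' ?_
  rw [distrAct_l2ToDistr_smooth, hx, map_zero, map_zero]

end Rep

theorem IsInversePair.injectiveOnSmooth {k k' : Fin ν → ℂ} {g : 𝒜.obj k} {g' : 𝒜.obj k'}
    (h : IsInversePair g g') (S : Set (Rep.{u, v} 𝒜)) : InjectiveOnSmooth S g := fun _ _ =>
  ⟨(injective_iff_map_eq_zero _).2 fun _ hx => Rep.smoothAct_eq_zero h hx,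
    (injective_iff_map_eq_zero _).2 fun _ hx => Rep.smoothAct_eq_zero (h.adj rfl rfl) hx⟩

theorem InjectiveOnSmooth.mul {S : Set (Rep.{u, v} 𝒜)} {k l m : Fin ν → ℂ} (h : k + l = m)
    {a : 𝒜.obj k} {b : 𝒜.obj l} (ha : InjectiveOnSmooth S a) (hb : InjectiveOnSmooth S b) :
    InjectiveOnSmooth S (𝒜.mul h a b) := fun π hπ => by
  have h' : star l + star k = star m := by rw [← h, star_add, add_comm]
  constructor
  · have := (ha π hπ).1.comp (hb π hπ).1
    convert this using 1
    funext x
    exact (π.smoothAct_smoothAct h a b x).symm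
  · rw [𝒜.adj_mul h rfl rfl rfl h']
    have := (hb π hπ).2.comp (ha π hπ).2
    convert this using 1
    funext x
    exact (π.smoothAct_smoothAct h' _ _ x).symm

theorem InjectiveOnSmooth.isUnit {S : Set (Rep.{u, v} 𝒜)} (hS : DetectsInvertibility S)
    (htr : ∀ k, HasTransport.{u, v} 𝒜 k) {a : 𝒜.obj 0} (ha : InjectiveOnSmooth S a) :
    IsUnit (𝒜.toCompleted₀ a) := by
  obtain ⟨b, hb⟩ := (exists_left_inverse_iff hS htr a).2 fun π hπ => (ha π hπ).1
  have hadj : ∀ π ∈ S, Function.Injective (π.smoothAct (𝒜.adj (star_zero _) a)) := fun π hπ => by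
    have h0 : ∀ (m : Fin ν → ℂ) (hm : star (0 : Fin ν → ℂ) = m),
        Function.Injective (π.smoothAct (𝒜.adj hm a)) := fun m hm => by
      subst hm
      exact (ha π hπ).2
    exact h0 0 _
  obtain ⟨c, hc⟩ := (exists_left_inverse_iff hS htr _).2 hadj
  rw [toCompleted₀_adj] at hc
  have hc' : 𝒜.toCompleted₀ a * star c = 1 := by
    rw [← star_star (𝒜.toCompleted₀ a * star c), star_mul, star_star, hc, star_one]
  exact isUnit_iff_exists_and_exists.2 ⟨⟨_, hc'⟩, ⟨_, hb⟩⟩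

/-- Multiplying by `e'` of order `-k` on either side gives elements of order zero that inherit
injectivity, hence units. -/
theorem InjectiveOnSmooth.exists_isInversePair {S : Set (Rep.{u, v} 𝒜)}
    (hS : DetectsInvertibility S) (htr : ∀ k, HasTransport.{u, v} 𝒜 k) {k : Fin ν → ℂ}
    {a : 𝒜.obj k} (ha : InjectiveOnSmooth S a) : ∃ a' : 𝒜.obj (-k), IsInversePair a a' := by
  obtain ⟨e, e', he, -⟩ := hasInversePairs htr k
  have he' := he.symm.injectiveOnSmooth S
  exact ⟨e', add_neg_cancel k, neg_add_cancel k, (ha.mul _ he').isUnit hS htr,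
    (he'.mul _ ha).isUnit hS htr⟩

/-! ### Isomorphisms of spaces of smooth vectors and distribution vectors -/

namespace Rep

variable (π : Rep.{u, w} 𝒜)

/-- With `Z = (e d e')⁻¹`, applying the injective `e` to both sides gives `d e' Z e x = x`. For
invertible `d` this factors `d⁻¹` as `e' Z e` on smooth vectors. -/
theorem exists_bounded_inverse {k : Fin ν → ℂ} {e : 𝒜.obj k} {e' : 𝒜.obj (-k)}
    (hp : IsInversePair e e') (hk' : ∀ i, ((-k) i).re ≤ 0) {d : 𝒜.obj 0}
    (hd : IsUnit (𝒜.toCompleted₀ (𝒜.conj (add_neg_cancel k) e d e'))) :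
    ∃ Z : π.L2 →L[ℂ] π.L2, ∀ x : π.Smooth, π.l2Rep (𝒜.toCompleted₀ d)
      (π.bddAct hk' e' (Z (π.smoothToL2 (π.smoothAct e x)))) = π.smoothToL2 x := by
  obtain ⟨c, hc⟩ := hd
  refine ⟨π.l2Rep (↑c⁻¹ : 𝒜.Completed₀), fun x => ?_⟩
  rw [← sub_eq_zero]
  refine π.eq_zero_of_distrAct_eq_zero hp.add_eq' e' e hp.isUnit' ?_
  rw [map_sub, map_sub, ← distrAct_l2ToDistr_zero, ← distrAct_l2ToDistr,
    ← π.distrAct_conj (add_neg_cancel k), distrAct_l2ToDistr_zero, distrAct_l2ToDistr_smooth, ← hc,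
    sub_eq_zero]
  congr 1
  change (π.l2Rep (c : 𝒜.Completed₀) * π.l2Rep (↑c⁻¹ : 𝒜.Completed₀)) _ = _
  rw [← map_mul, Units.mul_inv, map_one]
  rfl

/-- The `L²` solution equals `e' Z e y` for pairs of every order, so it is smooth. -/
theorem exists_smoothAct_eq (hpairs : HasInversePairs 𝒜) {d : 𝒜.obj 0}
    (hd : IsUnit (𝒜.toCompleted₀ d)) (y : π.Smooth) : ∃ x, π.smoothAct d x = y := by
  obtain ⟨c, hc⟩ := id hd
  let ξ : π.L2 := π.l2Rep (↑c⁻¹ : 𝒜.Completed₀) (π.smoothToL2 y)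
  have hξ : π.l2Rep (𝒜.toCompleted₀ d) ξ = π.smoothToL2 y := by
    rw [← hc]
    change (π.l2Rep (c : 𝒜.Completed₀) * π.l2Rep (↑c⁻¹ : 𝒜.Completed₀)) _ = _
    rw [← map_mul, Units.mul_inv, map_one]
    rfl
  obtain ⟨x, hx⟩ := π.exists_smooth_of_forall (ξ := ξ) fun k hk => by
    obtain ⟨e, e', hp, hconj⟩ := hpairs fun i => (k i : ℂ)
    have hk' : ∀ i, ((-(fun i => (k i : ℂ)) : Fin ν → ℂ) i).re ≤ 0 := fun i => by simpa using hk i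
    obtain ⟨Z, hZ⟩ := π.exists_bounded_inverse hp hk' (hconj d hd)
    refine ⟨e', Z (π.smoothToL2 (π.smoothAct e y)), ?_⟩
    rw [π.distrAct_l2ToDistr hk']
    congr 1
    rw [← sub_eq_zero]
    refine π.l2Rep_injective_of_isUnit hd ?_
    rw [map_sub, hZ, hξ, sub_self]
  refine ⟨x, π.smoothToL2_injective ?_⟩
  rw [← hξ, ← hx, l2Rep_toCompleted₀, bddAct_smoothToL2]

/-- Elliptic estimate: `x = e' Z e (d x)`, and `b e'` has order at most zero. -/
theorem exists_norm_smoothAct_le {k : Fin ν → ℂ} {e : 𝒜.obj k} {e' : 𝒜.obj (-k)}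
    (hp : IsInversePair e e') (hk : ∀ i, 0 ≤ (k i).re) {d : 𝒜.obj 0}
    (hd : IsUnit (𝒜.toCompleted₀ d))
    (hconj : IsUnit (𝒜.toCompleted₀ (𝒜.conj (add_neg_cancel k) e d e'))) {l : Fin ν → ℂ}
    (b : 𝒜.obj l) (hl : ∀ i, (l i).re ≤ (k i).re) :
    ∃ C : ℝ, 0 ≤ C ∧ ∀ x, ‖π.smoothToL2 (π.smoothAct b x)‖ ≤
      C * ‖π.smoothToL2 (π.smoothAct e (π.smoothAct d x))‖ := by
  have hk' : ∀ i, ((-k) i).re ≤ 0 := fun i => by simpa using hk i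
  obtain ⟨Z, hZ⟩ := π.exists_bounded_inverse hp hk' hconj
  have hre : ∀ i, ((l + -k) i).re ≤ 0 := fun i => by simpa using hl i
  refine ⟨‖π.bddAct hre (𝒜.mul rfl b e') ∘L Z‖, norm_nonneg _, fun x => ?_⟩
  have h1 : π.bddAct hk' e' (Z (π.smoothToL2 (π.smoothAct e (π.smoothAct d x)))) =
      π.smoothToL2 x := by
    rw [← sub_eq_zero]
    refine π.l2Rep_injective_of_isUnit hd ?_
    rw [map_sub, hZ, l2Rep_toCompleted₀, bddAct_smoothToL2, sub_self]
  have h2 : π.smoothToL2 (π.smoothAct b x) = (π.bddAct hre (𝒜.mul rfl b e') ∘L Z)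
      (π.smoothToL2 (π.smoothAct e (π.smoothAct d x))) := by
    refine π.l2ToDistr_injective ?_
    rw [← distrAct_l2ToDistr_smooth, ← h1, ContinuousLinearMap.comp_apply, ← distrAct_l2ToDistr,
      ← distrAct_l2ToDistr, distrAct_distrAct π rfl]
  rw [h2]
  exact ContinuousLinearMap.le_opNorm _ _

variable {π}

theorem smoothAct_bijective (hpairs : HasInversePairs 𝒜) {k k' : Fin ν → ℂ} {g : 𝒜.obj k}
    {g' : 𝒜.obj k'} (h : IsInversePair g g') : Function.Bijective (π.smoothAct g) := by
  refine ⟨(injective_iff_map_eq_zero _).2 fun _ hx => smoothAct_eq_zero h hx, fun y => ?_⟩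
  obtain ⟨x, hx⟩ := π.exists_smoothAct_eq hpairs h.isUnit y
  exact ⟨π.smoothAct g' x, by rw [π.smoothAct_smoothAct h.add_eq, hx]⟩

theorem isHomeomorph_smoothAct (hpairs : HasInversePairs 𝒜) {k k' : Fin ν → ℂ} {g : 𝒜.obj k}
    {g' : 𝒜.obj k'} (h : IsInversePair g g') : IsHomeomorph (π.smoothAct g) := by
  refine isHomeomorph_of_seminorm_le π.withSeminorms_smooth (π.smoothAct g).toLinearMap
    (π.smoothAct g).continuous (smoothAct_bijective hpairs h) fun ⟨l, b⟩ => ?_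
  obtain ⟨e, e', hp, hconj⟩ := hpairs fun i => ((|(l i).re| : ℝ) : ℂ)
  obtain ⟨C, hC, hle⟩ := π.exists_norm_smoothAct_le hp (fun i => abs_nonneg _) h.isUnit'
    (hconj _ h.isUnit') b (fun i => le_abs_self _)
  let c : NNReal := ⟨C, hC⟩
  refine ⟨c • π.smoothSeminorm ⟨_, 𝒜.mul rfl e g'⟩,
    (π.withSeminorms_smooth.continuous_seminorm _).const_smul c, fun x => ?_⟩
  have h1 : π.smoothSeminorm ⟨l, b⟩ x = ‖π.smoothToL2 (π.smoothAct b x)‖ :=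
    (Completion.norm_coe (E := π.V) _).symm
  have h2 : π.smoothSeminorm ⟨_, 𝒜.mul rfl e g'⟩ (π.smoothAct g x) =
      ‖π.smoothToL2 (π.smoothAct e (π.smoothAct (𝒜.mul h.add_eq' g' g) x))‖ := by
    rw [← π.smoothAct_smoothAct h.add_eq', π.smoothAct_smoothAct rfl e]
    exact (Completion.norm_coe (E := π.V) _).symm
  rw [h1]
  change _ ≤ C * π.smoothSeminorm ⟨_, 𝒜.mul rfl e g'⟩ (π.smoothAct g x)
  rw [h2]
  exact hle x

/-- The action on distribution vectors is the transpose of `g*` on smooth vectors, so the transpose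
of the inverse there is a continuous inverse. -/
theorem isHomeomorph_distrAct (hpairs : HasInversePairs 𝒜) {k k' : Fin ν → ℂ} {g : 𝒜.obj k}
    {g' : 𝒜.obj k'} (h : IsInversePair g g') : IsHomeomorph (π.distrAct g) := by
  have hh := isHomeomorph_smoothAct (π := π) hpairs (h.adj rfl rfl)
  obtain ⟨-, f, hl, hr, hf⟩ := isHomeomorph_iff_exists_inverse.1 hh
  let e := LinearEquiv.ofBijective (π.smoothAct (𝒜.adj rfl g)).toLinearMap hh.bijective
  have hef : ∀ y, e.symm y = f y := fun y => e.symm_apply_eq.2 (hr y).symm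
  let F : π.Smooth →L[ℂ] π.Smooth :=
    ⟨e.symm.toLinearMap, by
      change Continuous fun y => e.symm y
      simp_rw [hef]
      exact hf⟩
  refine isHomeomorph_iff_exists_inverse.2 ⟨(π.distrAct g).continuous,
    PointwiseConvergenceCLM.precomp ℂ F, fun ξ => ?_, fun ξ => ?_,
    (PointwiseConvergenceCLM.precomp ℂ F).continuous⟩
  · ext η
    exact congrArg ξ ((congrArg _ (hef η)).trans (hr η))
  · ext η
    exact congrArg ξ ((hef _).trans (hl η))

/-! ### Sobolev spaces -/

theorem continuous_l2ToDistr : Continuous π.l2ToDistr :=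
  PointwiseConvergenceCLM.continuous_of_continuous_eval fun η => by
    change Continuous fun ξ => inner ℂ (π.smoothToL2 η) ξ
    fun_prop

theorem exists_distrAct_eq {k k' : Fin ν → ℂ} (hpairs : HasInversePairs 𝒜) {g : 𝒜.obj k}
    {g' : 𝒜.obj k'} (h : IsInversePair g g') : ∃ Z : π.L2 →L[ℂ] π.L2, ∀ (ξ : π.Distr) (η : π.L2),
      π.distrAct g ξ = π.l2ToDistr η → ξ = π.distrAct g' (π.l2ToDistr (Z η)) := by
  obtain ⟨c, hc⟩ := h.isUnit
  refine ⟨π.l2Rep (↑c⁻¹ : 𝒜.Completed₀), fun ξ η hξ => ?_⟩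
  refine (isHomeomorph_distrAct hpairs h).injective ?_
  rw [hξ, distrAct_distrAct π h.add_eq, distrAct_l2ToDistr_zero, ← hc]
  congr 1
  change _ = (π.l2Rep (c : 𝒜.Completed₀) * π.l2Rep (↑c⁻¹ : 𝒜.Completed₀)) _
  rw [← map_mul, Units.mul_inv, map_one]
  rfl

/-- Approximate `ζ` in `L²` by smooth vectors and apply `g'`: for the admissible `b` the products `b
g'` are bounded, so one sequence serves them all. -/
theorem distrAct_l2ToDistr_mem_sobolev {k' : Fin ν → ℂ} (g' : 𝒜.obj k') {s : Fin ν → ℝ}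
    (hs : ∀ i, (k' i).re ≤ -s i) (ζ : π.L2) :
    π.distrAct g' (π.l2ToDistr ζ) ∈ π.sobolevSubmodule s := by
  obtain ⟨y, hy⟩ : ∃ y : ℕ → π.Smooth, Tendsto (fun n => π.smoothToL2 (y n)) atTop (𝓝 ζ) := by
    obtain ⟨z, hz, hlim⟩ := mem_closure_iff_seq_limit.1 (π.denseRange_smoothToL2 ζ)
    choose y hy using hz
    exact ⟨y, by simpa only [hy] using hlim⟩
  refine ⟨fun n => π.smoothAct g' (y n), ?_, fun l b hl => ?_⟩
  · simp_rw [← distrAct_l2ToDistr_smooth]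
    exact (((π.distrAct g').continuous.comp continuous_l2ToDistr).tendsto ζ).comp hy
  · have hre : ∀ i, ((l + k') i).re ≤ 0 := fun i => by
      have h1 := hl i
      have h2 := hs i
      simp only [Pi.add_apply, Complex.add_re]
      linarith
    refine ⟨π.bddAct hre (𝒜.mul rfl b g') ζ, ?_, ?_⟩
    · rw [distrAct_distrAct π rfl, distrAct_l2ToDistr]
    · simp_rw [smoothAct_smoothAct π rfl, ← bddAct_smoothToL2 π hre]
      exact ((π.bddAct hre _).continuous.tendsto ζ).comp hy

theorem IsInversePair.re_eq {k k' : Fin ν → ℂ} {g : 𝒜.obj k} {g' : 𝒜.obj k'}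
    (h : IsInversePair g g') (i : Fin ν) : (k' i).re = -(k i).re := by
  have := congrArg Complex.re (congrFun h.add_eq i)
  simp only [Pi.add_apply, Complex.add_re, Pi.zero_apply, Complex.zero_re] at this
  linarith

/-- A single element with an inverse partner tests Sobolev regularity, since `ξ = g' Z η` with `η =
g ξ` in `L²`. -/
theorem mem_sobolev_of_distrAct {k k' : Fin ν → ℂ} (hpairs : HasInversePairs 𝒜) {g : 𝒜.obj k}
    {g' : 𝒜.obj k'} (h : IsInversePair g g') {s : Fin ν → ℝ} (hs : ∀ i, s i ≤ (k i).re)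
    {ξ : π.Distr} (hξ : π.distrAct g ξ ∈ Set.range π.l2ToDistr) : ξ ∈ π.sobolevSubmodule s := by
  obtain ⟨η, hη⟩ := hξ
  obtain ⟨Z, hZ⟩ := exists_distrAct_eq (π := π) hpairs h
  rw [hZ ξ η hη.symm]
  exact distrAct_l2ToDistr_mem_sobolev g' (fun i => by
    rw [IsInversePair.re_eq h i]
    linarith [hs i]) _

instance (s : Fin ν → ℝ) : IsUniformAddGroup (π.Sobolev s) :=
  isUniformAddGroup_iInf fun a =>
    (π.sobolevSeminorm s a).toSeminormedAddCommGroup.to_isUniformAddGroup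

theorem withSeminorms_sobolev (s : Fin ν → ℝ) : WithSeminorms (π.sobolevSeminorm s) :=
  (SeminormFamily.withSeminorms_iff_uniformSpace_eq_iInf _).2 rfl

theorem continuous_sobolevToL2 {s : Fin ν → ℝ} {l : Fin ν → ℂ} (hl : ∀ i, (l i).re ≤ s i)
    (a : 𝒜.obj l) : Continuous (π.sobolevToL2 hl a) :=
  (norm_withSeminorms ℂ π.L2).continuous_of_continuous_comp _ fun _ =>
    (π.withSeminorms_sobolev s).continuous_seminorm ⟨⟨l, hl⟩, a⟩

/-- The topology of `H^s(π)` is given by the norm `ξ ↦ ‖π_k(g) ξ‖`. -/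
theorem exists_norm_sobolevToL2_le {k k' : Fin ν → ℂ} (hpairs : HasInversePairs 𝒜) {g : 𝒜.obj k}
    {g' : 𝒜.obj k'} (h : IsInversePair g g') {s : Fin ν → ℝ} (hs : ∀ i, (k i).re = s i)
    {l : Fin ν → ℂ} (hl : ∀ i, (l i).re ≤ s i) (b : 𝒜.obj l) :
    ∃ C : NNReal, ∀ ξ : π.Sobolev s,
      ‖π.sobolevToL2 hl b ξ‖ ≤ C * ‖π.sobolevToL2 (fun i => (hs i).le) g ξ‖ := by
  obtain ⟨Z, hZ⟩ := exists_distrAct_eq (π := π) hpairs h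
  have hre : ∀ i, ((l + k') i).re ≤ 0 := fun i => by
    have h1 := hl i
    have h2 := IsInversePair.re_eq h i
    have h3 := hs i
    simp only [Pi.add_apply, Complex.add_re]
    linarith
  refine ⟨‖π.bddAct hre (𝒜.mul rfl b g') ∘L Z‖₊, fun ξ => ?_⟩
  have h1 : π.sobolevToL2 hl b ξ = (π.bddAct hre (𝒜.mul rfl b g') ∘L Z)
      (π.sobolevToL2 (fun i => (hs i).le) g ξ) := by
    refine π.l2ToDistr_injective ?_
    rw [l2ToDistr_sobolevToL2, hZ _ _ (π.l2ToDistr_sobolevToL2 (fun i => (hs i).le) g ξ).symm,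
      distrAct_distrAct π rfl, distrAct_l2ToDistr π hre]
    rfl
  rw [h1]
  exact ContinuousLinearMap.le_opNorm _ _

theorem isHomeomorph_sobolevToL2 {k k' : Fin ν → ℂ} (hpairs : HasInversePairs 𝒜) {g : 𝒜.obj k}
    {g' : 𝒜.obj k'} (h : IsInversePair g g') {s : Fin ν → ℝ} (hs : ∀ i, (k i).re = s i) :
    IsHomeomorph (π.sobolevToL2 (fun i => (hs i).le) g) := by
  refine isHomeomorph_of_seminorm_le (π.withSeminorms_sobolev s) _
    (π.continuous_sobolevToL2 _ g) ⟨fun ξ ξ' heq => ?_, fun η => ?_⟩ fun ⟨⟨l, hl⟩, b⟩ => ?_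
  · have := congrArg π.l2ToDistr heq
    rw [l2ToDistr_sobolevToL2, l2ToDistr_sobolevToL2] at this
    exact Subtype.ext ((isHomeomorph_distrAct hpairs h).injective this)
  · obtain ⟨ξ, hξ⟩ := (isHomeomorph_distrAct (π := π) hpairs h).surjective (π.l2ToDistr η)
    refine ⟨⟨ξ, mem_sobolev_of_distrAct hpairs h (fun i => (hs i).ge) ⟨η, hξ.symm⟩⟩, ?_⟩
    exact π.l2ToDistr_injective ((π.l2ToDistr_sobolevToL2 (fun i => (hs i).le) g _).trans hξ)
  · obtain ⟨C, hC⟩ := exists_norm_sobolevToL2_le (π := π) hpairs h hs hl b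
    exact ⟨C • normSeminorm ℂ π.L2, continuous_norm.const_smul C, hC⟩

theorem isHilbertian_sobolev (hpairs : HasInversePairs 𝒜) (s : Fin ν → ℝ) :
    IsHilbertian (π.Sobolev s) := by
  obtain ⟨e, e', hp, -⟩ := hpairs fun i => (s i : ℂ)
  have hh := isHomeomorph_sobolevToL2 (π := π) hpairs hp (s := s) fun i => Complex.ofReal_re _
  obtain ⟨hc, f, hl, hr, hf⟩ := isHomeomorph_iff_exists_inverse.1 hh
  let E := LinearEquiv.ofBijective _ hh.bijective
  refine ⟨π.L2, inferInstance, inferInstance, inferInstance, ⟨⟨E, hc, ?_⟩⟩⟩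
  have hef : ∀ y, E.symm y = f y := fun y => E.symm_apply_eq.2 (hr y).symm
  change Continuous fun y => E.symm y
  simp_rw [hef]
  exact hf

theorem sobolevSubmodule_eq (hpairs : HasInversePairs 𝒜) (s : Fin ν → ℝ) :
    (π.sobolevSubmodule s : Set π.Distr) =
      {ξ | ∀ a : 𝒜.obj (fun i => (s i : ℂ)), π.distrAct a ξ ∈ Set.range π.l2ToDistr} := by
  ext ξ
  constructor
  · rintro ⟨x, -, hx⟩ a
    obtain ⟨ζ, hζ, -⟩ := hx _ a fun i => (Complex.ofReal_re _).le
    exact ⟨ζ, hζ.symm⟩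
  · intro hξ
    obtain ⟨e, e', hp, -⟩ := hpairs fun i => (s i : ℂ)
    exact mem_sobolev_of_distrAct hpairs hp (fun i => (Complex.ofReal_re _).ge) (hξ e)

theorem l2ToDistr_sobolevToL2_sobolevAct {k l : Fin ν → ℂ} (a : 𝒜.obj k) {s : Fin ν → ℝ}
    (hl : ∀ i, (l i).re ≤ s i - (k i).re) (hl' : ∀ i, ((l + k) i).re ≤ s i) (b : 𝒜.obj l)
    (ξ : π.Sobolev s) :
    π.sobolevToL2 hl b (π.sobolevAct a s ξ) = π.sobolevToL2 hl' (𝒜.mul rfl b a) ξ := by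
  refine π.l2ToDistr_injective ?_
  rw [l2ToDistr_sobolevToL2, l2ToDistr_sobolevToL2]
  exact π.distrAct_distrAct rfl b a _

/-- The auxiliary `f` brings the real order of `f g` up to `s`, so `‖f g ξ‖` is a norm for the
topology of `H^s`, while it is also a continuous seminorm of `g ξ` in the target. -/
theorem isHomeomorph_sobolevAct {k k' : Fin ν → ℂ} (hpairs : HasInversePairs 𝒜) {g : 𝒜.obj k}
    {g' : 𝒜.obj k'} (h : IsInversePair g g') (s : Fin ν → ℝ) {l : Fin ν → ℂ} {f : 𝒜.obj l}
    (hl : ∀ i, (l i).re = s i - (k i).re) {m' : Fin ν → ℂ} {f' : 𝒜.obj m'}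
    (hf : IsInversePair (𝒜.mul rfl f g) f') : IsHomeomorph (π.sobolevAct g s) := by
  have hlk : ∀ i, ((l + k) i).re = s i := fun i => by
    simp only [Pi.add_apply, Complex.add_re, hl]
    ring
  refine isHomeomorph_of_seminorm_le (π.withSeminorms_sobolev s) _ ?_
    ⟨fun ξ ξ' heq => ?_, fun η => ?_⟩ fun ⟨⟨n, hn⟩, b⟩ => ?_
  · refine (π.withSeminorms_sobolev _).continuous_of_continuous_comp _ fun ⟨⟨n, hn⟩, b⟩ => ?_
    have hn' : ∀ i, ((n + k) i).re ≤ s i := fun i => by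
      have := hn i
      simp only [Pi.add_apply, Complex.add_re]
      linarith
    change Continuous fun ξ => ‖π.sobolevToL2 hn b (π.sobolevAct g s ξ)‖
    simp_rw [π.l2ToDistr_sobolevToL2_sobolevAct g hn hn' b]
    exact (π.continuous_sobolevToL2 hn' _).norm
  · exact Subtype.ext ((isHomeomorph_distrAct hpairs h).injective (congrArg Subtype.val heq))
  · obtain ⟨ξ, hξ⟩ := (isHomeomorph_distrAct (π := π) hpairs h).surjective η.1
    refine ⟨⟨ξ, mem_sobolev_of_distrAct hpairs hf (fun i => (hlk i).ge) ?_⟩, Subtype.ext hξ⟩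
    refine ⟨π.sobolevToL2 (fun i => (hl i).le) f η, ?_⟩
    rw [← π.distrAct_distrAct rfl, hξ, l2ToDistr_sobolevToL2]
    rfl
  · obtain ⟨C, hC⟩ := exists_norm_sobolevToL2_le (π := π) hpairs hf hlk hn b
    refine ⟨C • π.sobolevSeminorm _ ⟨⟨l, fun i => (hl i).le⟩, f⟩,
      ((π.withSeminorms_sobolev _).continuous_seminorm _).const_smul C, fun ξ => ?_⟩
    refine (hC ξ).trans_eq ?_
    rw [← π.l2ToDistr_sobolevToL2_sobolevAct g (fun i => (hl i).le)]
    rfl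

theorem smoothAct_adj_adj {k l m : Fin ν → ℂ} (hl : star k = l) (hm : star l = m) (a : 𝒜.obj k)
    (x : π.Smooth) : π.smoothAct (𝒜.adj hm (𝒜.adj hl a)) x = π.smoothAct a x := by
  obtain rfl : k = m := by rw [← hm, ← hl, star_star]
  rw [𝒜.adj_adj]

/-- Continuity bounds `ξ` by finitely many seminorms, all dominated by `‖e x‖` for one `e` of large
order `k`. Riesz representation gives `ξ = e* ζ` with `ζ` in `L²`, so `ξ` lies in `H^{-k}`. -/
theorem exists_mem_sobolev (hpairs : HasInversePairs 𝒜) (ξ : π.Distr) :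
    ∃ s, ξ ∈ π.sobolevSubmodule s := by
  let f : π.Smooth →ₗ[ℂ] ℂ :=
    { toFun := fun η => star (ξ η)
      map_add' := fun η η' => by rw [map_add, star_add]
      map_smul' := fun r η => by rw [map_smulₛₗ]; simp }
  let q : Seminorm ℂ π.Smooth := (normSeminorm ℂ ℂ).comp f
  have hq : Continuous q := by
    change Continuous fun η => ‖star (ξ η)‖
    exact (continuous_star.comp ξ.continuous).norm
  obtain ⟨I, C, -, hC⟩ := Seminorm.bound_of_continuous π.withSeminorms_smooth q hq
  let k : Fin ν → ℝ := fun i => ∑ b ∈ I, |(b.1 i).re|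
  have hk : ∀ i, 0 ≤ k i := fun i => Finset.sum_nonneg fun b _ => abs_nonneg _
  obtain ⟨e, e', hp, hconj⟩ := hpairs fun i => (k i : ℂ)
  have hone : IsUnit (𝒜.toCompleted₀ 𝒜.one) := by
    rw [toCompleted₀_one]
    exact isUnit_one
  have hbd : ∀ b ∈ I, ∃ D : ℝ, 0 ≤ D ∧ ∀ x, π.smoothSeminorm b x ≤
      D * ‖π.smoothToL2 (π.smoothAct e x)‖ := fun b hb => by
    obtain ⟨D, hD, hle⟩ := π.exists_norm_smoothAct_le hp hk hone (hconj _ hone) b.2 fun i =>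
      (le_abs_self _).trans (Finset.single_le_sum (f := fun b : (k : Fin ν → ℂ) × 𝒜.obj k =>
        |(b.1 i).re|) (fun b _ => abs_nonneg _) hb)
    refine ⟨D, hD, fun x => ?_⟩
    have h2 := hle x
    rw [smoothAct_one] at h2
    exact (Completion.norm_coe (E := π.V) _).symm.trans_le h2
  choose! D hD hle using hbd
  have hbound : ∀ x, ‖f x‖ ≤
      (C * ∑ b ∈ I, D b) * ‖(π.smoothToL2 ∘ₗ (π.smoothAct e).toLinearMap) x‖ := fun x => by
      refine (hC x).trans ?_
      rw [_root_.mul_assoc]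
      refine mul_le_mul_of_nonneg_left (Seminorm.finset_sup_apply_le
        (mul_nonneg (Finset.sum_nonneg hD) (norm_nonneg _)) fun b hb => (hle b hb x).trans ?_) C.2
      exact mul_le_mul_of_nonneg_right (Finset.single_le_sum hD hb) (norm_nonneg _)
  -- Since `e` is onto the smooth vectors, the functional `e x ↦ star (ξ x)` is densely defined in
  -- `L²`.
  have hdense : DenseRange (π.smoothToL2 ∘ₗ (π.smoothAct e).toLinearMap) := by
    have := π.denseRange_smoothToL2
    rwa [DenseRange, ← (smoothAct_bijective hpairs hp).surjective.range_comp] at this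
  let ζ : π.L2 := (InnerProductSpace.toDual ℂ π.L2).symm
    (f.extendOfNorm (π.smoothToL2 ∘ₗ (π.smoothAct e).toLinearMap))
  have hζ : ∀ x, inner ℂ ζ (π.smoothToL2 (π.smoothAct e x)) = star (ξ x) := fun x => by
    rw [InnerProductSpace.toDual_symm_apply]
    exact LinearMap.extendOfNorm_eq hdense ⟨_, hbound⟩ x
  have hξ : ξ = π.distrAct (𝒜.adj rfl e) (π.l2ToDistr ζ) := by
    ext x
    rw [distrAct_apply, l2ToDistr_apply, ← inner_conj_symm, smoothAct_adj_adj, hζ]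
    exact (star_star _).symm
  refine ⟨fun i => -k i, ?_⟩
  rw [hξ]
  exact distrAct_l2ToDistr_mem_sobolev _ (fun i => by simp) ζ

end Rep

end CStarCalculus

/-! ### Assembly of the theorem. -/

theorem mainTheorem1 {ν : ℕ} (hν : 1 ≤ ν) (𝒜 : CStarCalculus.{u} ν)
    (S : Set (CStarCalculus.Rep.{u, v} 𝒜))
    (hI : IsTypeI 𝒜.Completed₀)
    (hS : ∀ (H : Type u) [NormedAddCommGroup H] [InnerProductSpace ℂ H] [CompleteSpace H]
      (ρ : 𝒜.Completed₀ →⋆ₐ[ℂ] (H →L[ℂ] H)), IsIrreducibleRep ρ →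
        ∃ π ∈ S, UnitarilyEquivalent ρ π.l2Rep)
    (hv : ∃ v : ∀ k : Fin ν → ℂ, 𝒜.obj k,
      IsUnit (𝒜.toCompleted₀ (v 0)) ∧
      ∀ a : 𝒜.obj 0, ContinuousOn (fun k : Fin ν → ℂ =>
        𝒜.toCompleted₀ (𝒜.mul (add_neg_cancel k) (𝒜.mul (add_zero k) (v k) a) (v (-k))))
        (CStarCalculus.orderCross ν)) :
    (∀ (k : Fin ν → ℂ) (a : 𝒜.obj k), CStarCalculus.InjectiveOnSmooth S a →
      ∀ π : CStarCalculus.Rep.{u, w} 𝒜, π.ActsByTopIso a) ∧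
    (∀ k : Fin ν → ℂ, ∃ a : 𝒜.obj k, CStarCalculus.InjectiveOnSmooth S a ∧
      ∀ π : CStarCalculus.Rep.{u, w} 𝒜, π.ActsByTopIso a) ∧
    (∀ (π : CStarCalculus.Rep.{u, w} 𝒜) (k : Fin ν → ℝ),
      IsHilbertian (π.Sobolev k) ∧
      (π.sobolevSubmodule k : Set π.Distr) =
        {ξ | ∀ a : 𝒜.obj (fun i => (k i : ℂ)), π.distrAct a ξ ∈ Set.range π.l2ToDistr}) ∧
    (∀ π : CStarCalculus.Rep.{u, w} 𝒜,
      (⋃ k : Fin ν → ℝ, (π.sobolevSubmodule k : Set π.Distr)) = Set.univ) ∧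
    (∀ a : 𝒜.obj 0, (∃ b : 𝒜.Completed₀, b * 𝒜.toCompleted₀ a = 1) ↔
      ∀ π ∈ S, Function.Injective (π.smoothAct a)) := by
  obtain ⟨x, h0, hcont⟩ := hv
  have hS' : CStarCalculus.DetectsInvertibility S := CStarCalculus.detectsInvertibility hI hS
  have hx : CStarCalculus.IsContinuousFamily x := ⟨h0, hcont⟩
  have htr : ∀ k, CStarCalculus.HasTransport.{u, v} 𝒜 k := hx.hasTransport_all hS'
  have hpairs := CStarCalculus.hasInversePairs htr
  have hiso : ∀ (k : Fin ν → ℂ) (a : 𝒜.obj k), CStarCalculus.InjectiveOnSmooth S a →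
      ∀ π : CStarCalculus.Rep.{u, w} 𝒜, π.ActsByTopIso a := fun k a ha π => by
    obtain ⟨a', h⟩ := ha.exists_isInversePair hS' htr
    refine ⟨CStarCalculus.Rep.isHomeomorph_distrAct hpairs h, fun l => ?_,
      CStarCalculus.Rep.isHomeomorph_smoothAct hpairs h⟩
    -- An element `f` of order `l - k` gives `f a` of the real order `l`. It is again injective, so
    -- it too has an inverse partner.
    obtain ⟨f, f', hf, -⟩ := hpairs fun i => (l i : ℂ) - k i
    obtain ⟨g, hg⟩ := ((hf.injectiveOnSmooth S).mul rfl ha).exists_isInversePair hS' htr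
    exact CStarCalculus.Rep.isHomeomorph_sobolevAct hpairs h l (fun i => by simp) hg
  refine ⟨hiso, fun k => ?_, fun π k => ⟨CStarCalculus.Rep.isHilbertian_sobolev hpairs k,
    CStarCalculus.Rep.sobolevSubmodule_eq hpairs k⟩, fun π => ?_,
    CStarCalculus.exists_left_inverse_iff hS' htr⟩
  · obtain ⟨e, e', he, -⟩ := hpairs k
    exact ⟨e, he.injectiveOnSmooth S, hiso k e (he.injectiveOnSmooth S)⟩
  · exact Set.eq_univ_of_forall fun ξ =>
      Set.mem_iUnion.2 (CStarCalculus.Rep.exists_mem_sobolev hpairs ξ)
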